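/- For a bounded closed planar region $A$ of area $S(A)$, let $W'(A)$ denote the least number of closed unit squares (arbitrarily placed and rotated, overlaps allowed) whose union contains $A$, minus $S(A)$. For $h,a>0$ and $0<\theta<\pi/2$, let $T(h,a,\theta)$ be the trapezoid of height $h$ with horizontal top edge of length $a$, vertical left-hand side, right-hand side making the angle $\theta$ with the vertical, and bottom edge of length $a+h\tan\theta$. (i) Let $c\le 7$, $x\ge 1$ and $x^{3/4}\le x'\le cx$. Every rectangle $T_1$ of length $x$ and width $x'$ satisfies $$W'(T_1)\le\bigl((15+c)\sqrt2+38\bigr)x^{5/8}.$$ (ii) Let $x'=x'(x)$ and $\theta=\theta(x)$ satisfy $x'\sim 2x^{1/2}$ as $x\to\infty$ and $0<\theta<\sqrt2\,x^{-1/2}$ for all sufficiently large $x$. Then, for all sufficiently large $x$, the trapezoid $T_2=T(x,x',\theta)$ satisfies $$W'(T_2)\le\Bigl(\frac{19}{2}+\frac72\sqrt2\Bigr)x^{5/6}.$$ (iii) Let $h=h(x)$ and $\theta=\theta(x)$ satisfy $h\sim\frac12x^{1/2}$ as $x\to\infty$ and $0<\theta<\sqrt2\,x^{-1/2}$ for all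 sufficiently large $x$, and let $a=\lfloor x^{1/3}-\sqrt2\,x^{1/6}\rfloor$. Then, for all sufficiently large $x$, the trapezoid $T_3=T(h,a,\theta)$ satisfies $$W'(T_3)\le\Bigl(\frac{19}{4}+\frac74\sqrt2\Bigr)x^{1/3}.$$ In particular, for every $x\ge1$, a square of side length $x$ has covering waste $W'(x)\le(16\sqrt2+38)x^{5/8}$; that is, it can be covered by at most $x^2+(16\sqrt2+38)x^{5/8}=x^2+O(x^{5/8})$ unit squares. -/

import Mathlib

open Filter MeasureTheory

namespace CoveringWaste

/-- The closed unit square in the plane with corner `p` and sides in the directions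
`(cos φ, sin φ)` and `(-sin φ, cos φ)`. -/
def unitSquare (p : ℝ × ℝ) (φ : ℝ) : Set (ℝ × ℝ) :=
  {q | ∃ s ∈ Set.Icc (0 : ℝ) 1, ∃ t ∈ Set.Icc (0 : ℝ) 1,
    q = (p.1 + s * Real.cos φ - t * Real.sin φ, p.2 + s * Real.sin φ + t * Real.cos φ)}

/-- `A` can be covered by `n` unit squares, arbitrarily placed, overlaps allowed. -/
def CoverableBy (A : Set (ℝ × ℝ)) (n : ℕ) : Prop :=
  ∃ (p : Fin n → ℝ × ℝ) (φ : Fin n → ℝ), A ⊆ ⋃ i, unitSquare (p i) (φ i)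

/-- A bounded planar set is covered by finitely many unit squares, so that the infimum in
`coverNumber` below is a minimum over a nonempty set. -/
theorem exists_coverableBy {A : Set (ℝ × ℝ)} (hA : Bornology.IsBounded A) :
    ∃ n, CoverableBy A n := by
  obtain ⟨R, hR⟩ := hA.subset_closedBall (0 : ℝ × ℝ)
  let F : Finset (ℤ × ℤ) := Finset.Icc ⌊-R⌋ ⌊R⌋ ×ˢ Finset.Icc ⌊-R⌋ ⌊R⌋
  let e := F.equivFin.symm
  refine ⟨F.card, fun i => (((e i).1.1 : ℝ), ((e i).1.2 : ℝ)), fun _ => 0, fun q hq => ?_⟩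
  have h := hR hq
  rw [mem_closedBall_zero_iff, Prod.norm_def, max_le_iff, Real.norm_eq_abs, Real.norm_eq_abs,
    abs_le, abs_le] at h
  have hm : (⌊q.1⌋, ⌊q.2⌋) ∈ F := by
    simp only [F, Finset.mem_product, Finset.mem_Icc]
    exact ⟨⟨Int.floor_mono h.1.1, Int.floor_mono h.1.2⟩,
      ⟨Int.floor_mono h.2.1, Int.floor_mono h.2.2⟩⟩
  refine Set.mem_iUnion.2 ⟨e.symm ⟨_, hm⟩, Int.fract q.1,
    ⟨Int.fract_nonneg _, (Int.fract_lt_one _).le⟩, Int.fract q.2,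
    ⟨Int.fract_nonneg _, (Int.fract_lt_one _).le⟩, ?_⟩
  simp

/-- The least number of unit squares that cover the (bounded) set `A`. -/
noncomputable def coverNumber (A : Set (ℝ × ℝ)) : ℕ := sInf {n | CoverableBy A n}

/-- The covering waste `W'(A)`: the least total area of unit squares covering `A` (each square
has area one and is counted separately, also where squares overlap), minus the area of `A`. -/
noncomputable def waste (A : Set (ℝ × ℝ)) : ℝ := (coverNumber A : ℝ) - (volume A).toReal

/-- The rectangle of length `l` and width `w`. -/
def rectangle (l w : ℝ) : Set (ℝ × ℝ) := Set.Icc 0 l ×ˢ Set.Icc 0 w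

/-- The right trapezoid of height `h` with horizontal top edge of length `a`, vertical left-hand
side, and right-hand side making the angle `θ` with the vertical, the bottom edge having length
`a + h * tan θ`. -/
def trapezoid (h a θ : ℝ) : Set (ℝ × ℝ) :=
  {q | 0 ≤ q.2 ∧ q.2 ≤ h ∧ 0 ≤ q.1 ∧ q.1 ≤ a + (h - q.2) * Real.tan θ}

end CoveringWaste

/-!
All coverings are explicit, and every bound comes from counting squares against area.

*Slabs.* Consider a trapezoid whose width grows from `b` to `b + t * H ≤ M`, where `M` is an integer
and `M - b ≤ 2`. It is filled from the right by rows of unit squares that are all tilted by the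
*same* angle `φ`, with `cos φ = 1 - 2 / M`, and from the left by vertical columns of upright squares.
Replacing one upright square in a horizontal row of length `M` by a tilted one shortens the row by
`1 - cos φ`; so the number `n j` of tilted squares in row `j` can be chosen such that the row has the
required width up to `1 - cos φ`. Since all tilted rows are parallel, no wedges occur between them.
The waste is `O(sin φ) = O(1 / √M)` per row, from the sawtooth ends, and `O(1)` per column, from the
two ends of the column outside the tilted block. This is `coverableWithin_slanted_rows` (the count)
and `coverableWithin_block` (the estimate). Adding full columns on the left gives
`coverableWithin_slab`, for any width. With `M` the integral top edge this is the third bound of the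
theorem.

*Tall trapezoids.* A trapezoid of height `r ^ 6`, width of order `r ^ 3` and slope at most
`1.42 / r ^ 3` is cut into about `2 * r ^ 3` slabs of an *integral* height `H ≈ r ^ 3 / 2`, so that the
full columns in them waste nothing. With `M ≈ r ^ 2` each slab wastes `O(r ^ 2)`, in total
`O(r ^ 5)`: this is `coverableWithin_trap`.

*Rectangles.* An `x × x'` rectangle is an integral rectangle together with two bands of width
`w ≈ x ^ (3 / 4)`. A band is covered by rows of `n = ⌊w⌋ + 1` squares, tilted by the angle with
`n * cos φ - sin φ = w` so that they fit the band exactly; they waste `tan φ ≈ √(2 / w)` each, in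
total about `√2 * x ^ (5 / 8)` per length `x` of band. The four ends of the bands are tall trapezoids
of height `w` and waste `O(w ^ (5 / 6)) = O(x ^ (5 / 8))` each. As the bound is claimed from `x = 1` on,
two cruder coverings supplement this one: up to `x = 256` a grid of upright squares, and up to
`x = 3 ^ 24` bands of width `x ^ (2 / 3)` with ends covered by upright rows, which waste
`O(x ^ (2 / 3))` with a constant that is small enough.
-/

namespace CoveringWaste

/-! ### Coverings: unions, symmetries, tilted rectangles -/

theorem CoverableBy.mono {A B : Set (ℝ × ℝ)} {n : ℕ} (hB : CoverableBy B n) (h : A ⊆ B) :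
    CoverableBy A n := by
  obtain ⟨p, φ, hp⟩ := hB
  exact ⟨p, φ, h.trans hp⟩

theorem coverableBy_of_fintype {ι : Type*} [Fintype ι] {A : Set (ℝ × ℝ)} (p : ι → ℝ × ℝ)
    (φ : ι → ℝ) (h : A ⊆ ⋃ i, unitSquare (p i) (φ i)) : CoverableBy A (Fintype.card ι) := by
  refine ⟨p ∘ (Fintype.equivFin ι).symm, φ ∘ (Fintype.equivFin ι).symm, fun q hq => ?_⟩
  obtain ⟨i, hi⟩ := Set.mem_iUnion.1 (h hq)
  exact Set.mem_iUnion.2 ⟨Fintype.equivFin ι i, by simpa using hi⟩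

theorem CoverableBy.iUnion {ι : Type*} [Fintype ι] {A : ι → Set (ℝ × ℝ)} {n : ι → ℕ}
    (h : ∀ i, CoverableBy (A i) (n i)) : CoverableBy (⋃ i, A i) (∑ i, n i) := by
  choose p φ hp using h
  have := coverableBy_of_fintype (A := ⋃ i, A i) (ι := Σ i, Fin (n i))
    (fun x => p x.1 x.2) (fun x => φ x.1 x.2) (by
      refine Set.iUnion_subset fun i q hq => ?_
      obtain ⟨k, hk⟩ := Set.mem_iUnion.1 (hp i hq)
      exact Set.mem_iUnion.2 ⟨⟨i, k⟩, hk⟩)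
  simpa using this

theorem CoverableBy.union {A B : Set (ℝ × ℝ)} {m n : ℕ} (hA : CoverableBy A m)
    (hB : CoverableBy B n) : CoverableBy (A ∪ B) (m + n) := by
  obtain ⟨p, φ, hp⟩ := hA
  obtain ⟨p', φ', hp'⟩ := hB
  have := coverableBy_of_fintype (A := A ∪ B) (ι := Fin m ⊕ Fin n)
    (Sum.elim p p') (Sum.elim φ φ') (by
      rintro q (hq | hq)
      · obtain ⟨k, hk⟩ := Set.mem_iUnion.1 (hp hq)
        exact Set.mem_iUnion.2 ⟨Sum.inl k, hk⟩
      · obtain ⟨k, hk⟩ := Set.mem_iUnion.1 (hp' hq)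
        exact Set.mem_iUnion.2 ⟨Sum.inr k, hk⟩)
  simpa using this

theorem coverableBy_empty (n : ℕ) : CoverableBy ∅ n :=
  ⟨fun _ => 0, fun _ => 0, Set.empty_subset _⟩

/-- If a map carries every unit square into a unit square, then preimages inherit coverings. -/
theorem CoverableBy.preimage {A : Set (ℝ × ℝ)} {n : ℕ} (hA : CoverableBy A n)
    (f : ℝ × ℝ → ℝ × ℝ) (hf : ∀ p φ, ∃ p' φ', f ⁻¹' unitSquare p φ ⊆ unitSquare p' φ') :
    CoverableBy (f ⁻¹' A) n := by
  obtain ⟨p, φ, hp⟩ := hA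
  choose g γ hg using hf
  refine ⟨fun i => g (p i) (φ i), fun i => γ (p i) (φ i), fun q hq => ?_⟩
  obtain ⟨i, hi⟩ := Set.mem_iUnion.1 (hp hq)
  exact Set.mem_iUnion.2 ⟨i, hg _ _ hi⟩

theorem CoverableBy.translate {A : Set (ℝ × ℝ)} {n : ℕ} (hA : CoverableBy A n) (a b : ℝ) :
    CoverableBy {q | (q.1 - a, q.2 - b) ∈ A} n := by
  refine hA.preimage (fun q => (q.1 - a, q.2 - b)) fun p φ => ⟨(p.1 + a, p.2 + b), φ, ?_⟩
  rintro q ⟨s, hs, t, ht, h⟩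
  obtain ⟨h1, h2⟩ := Prod.ext_iff.1 h
  exact ⟨s, hs, t, ht, Prod.ext (by simp only at h1 ⊢; linarith) (by simp only at h2 ⊢; linarith)⟩

theorem CoverableBy.swap {A : Set (ℝ × ℝ)} {n : ℕ} (hA : CoverableBy A n) :
    CoverableBy {q | (q.2, q.1) ∈ A} n := by
  refine hA.preimage (fun q => (q.2, q.1)) fun p φ => ⟨(p.2, p.1), -φ, ?_⟩
  rintro q ⟨s, hs, t, ht, h⟩
  obtain ⟨h1, h2⟩ := Prod.ext_iff.1 h
  refine ⟨t, ht, s, hs, Prod.ext ?_ ?_⟩ <;> simp only [Real.cos_neg, Real.sin_neg] at h1 h2 ⊢ <;>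
    linarith

theorem CoverableBy.reflect {A : Set (ℝ × ℝ)} {n : ℕ} (hA : CoverableBy A n) (b : ℝ) :
    CoverableBy {q | (q.1, b - q.2) ∈ A} n := by
  refine hA.preimage (fun q => (q.1, b - q.2)) fun p φ =>
    ⟨(p.1 - Real.sin φ, b - p.2 - Real.cos φ), -φ, ?_⟩
  rintro q ⟨s, hs, t, ht, h⟩
  obtain ⟨h1, h2⟩ := Prod.ext_iff.1 h
  refine ⟨s, hs, 1 - t, ⟨by linarith [ht.2], by linarith [ht.1]⟩, Prod.ext ?_ ?_⟩ <;>
    simp only [Real.cos_neg, Real.sin_neg] at h1 h2 ⊢ <;> linarith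

/-- The `l × w` rectangle with sides in the directions `(cos φ, sin φ)` and `(-sin φ, cos φ)`,
given by the ranges of the two coordinates in this rotated frame. -/
def tiltedRect (φ u v l w : ℝ) : Set (ℝ × ℝ) :=
  {q | q.1 * Real.cos φ + q.2 * Real.sin φ ∈ Set.Icc u (u + l) ∧
    -q.1 * Real.sin φ + q.2 * Real.cos φ ∈ Set.Icc v (v + w)}

theorem exists_fin_le {n : ℕ} (hn : 0 < n) {r : ℝ} (h0 : 0 ≤ r) (h1 : r ≤ n) :
    ∃ i : Fin n, (i : ℝ) ≤ r ∧ r ≤ i + 1 := by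
  rcases h1.lt_or_eq with h | h
  · exact ⟨⟨⌊r⌋₊, (Nat.floor_lt h0).2 h⟩, Nat.floor_le h0, (Nat.lt_floor_add_one r).le⟩
  · have : ((n - 1 : ℕ) : ℝ) = n - 1 := by rw [Nat.cast_sub hn]; simp
    refine ⟨⟨n - 1, by omega⟩, ?_, ?_⟩ <;> simp only [this] <;> linarith

theorem coverableBy_tiltedRect (φ u v : ℝ) {n k : ℕ} (hn : 0 < n) (hk : 0 < k) :
    CoverableBy (tiltedRect φ u v n k) (n * k) := by
  have := coverableBy_of_fintype (A := tiltedRect φ u v n k) (ι := Fin n × Fin k)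
    (fun i => ((u + i.1) * Real.cos φ - (v + i.2) * Real.sin φ,
      (u + i.1) * Real.sin φ + (v + i.2) * Real.cos φ)) (fun _ => φ) (by
      rintro q ⟨⟨h1, h2⟩, h3, h4⟩
      obtain ⟨i, hi, hi'⟩ := exists_fin_le hn (sub_nonneg.2 h1) (by linarith)
      obtain ⟨j, hj, hj'⟩ := exists_fin_le hk (sub_nonneg.2 h3) (by linarith)
      refine Set.mem_iUnion.2 ⟨(i, j), _, ⟨sub_nonneg.2 hi, by linarith⟩, _,
        ⟨sub_nonneg.2 hj, by linarith⟩, Prod.ext ?_ ?_⟩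
      · simp only
        linear_combination q.1 * (-Real.cos_sq_add_sin_sq φ)
      · simp only
        linear_combination q.2 * (-Real.cos_sq_add_sin_sq φ))
  simpa using this

theorem coverableBy_box {A : Set (ℝ × ℝ)} (a b : ℝ) {n k : ℕ} (hn : 0 < n) (hk : 0 < k)
    (hA : ∀ q ∈ A, a ≤ q.1 ∧ q.1 ≤ a + n ∧ b ≤ q.2 ∧ q.2 ≤ b + k) : CoverableBy A (n * k) := by
  refine (coverableBy_tiltedRect 0 a b hn hk).mono fun q hq => ?_
  obtain ⟨h1, h2, h3, h4⟩ := hA q hq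
  simp [tiltedRect, h1, h2, h3, h4]

/-- `A` can be covered by at most `r` unit squares, where the bound `r` is a real number. -/
def CoverableWithin (A : Set (ℝ × ℝ)) (r : ℝ) : Prop := ∃ n : ℕ, CoverableBy A n ∧ (n : ℝ) ≤ r

theorem CoverableWithin.mono {A B : Set (ℝ × ℝ)} {r r' : ℝ} (h : CoverableWithin B r)
    (hAB : A ⊆ B) (hr : r ≤ r') : CoverableWithin A r' := by
  obtain ⟨n, hn, hn'⟩ := h
  exact ⟨n, hn.mono hAB, hn'.trans hr⟩

theorem CoverableWithin.union {A B : Set (ℝ × ℝ)} {r r' : ℝ} (hA : CoverableWithin A r)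
    (hB : CoverableWithin B r') : CoverableWithin (A ∪ B) (r + r') := by
  obtain ⟨n, hn, hn'⟩ := hA
  obtain ⟨m, hm, hm'⟩ := hB
  exact ⟨n + m, hn.union hm, by push_cast; linarith⟩

theorem CoverableWithin.translate {A : Set (ℝ × ℝ)} {r : ℝ} (hA : CoverableWithin A r)
    (a b : ℝ) : CoverableWithin {q | (q.1 - a, q.2 - b) ∈ A} r :=
  hA.imp fun _ h => ⟨h.1.translate a b, h.2⟩

theorem CoverableWithin.swap {A : Set (ℝ × ℝ)} {r : ℝ} (hA : CoverableWithin A r) :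
    CoverableWithin {q | (q.2, q.1) ∈ A} r :=
  hA.imp fun _ h => ⟨h.1.swap, h.2⟩

theorem CoverableWithin.reflect {A : Set (ℝ × ℝ)} {r : ℝ} (hA : CoverableWithin A r) (b : ℝ) :
    CoverableWithin {q | (q.1, b - q.2) ∈ A} r :=
  hA.imp fun _ h => ⟨h.1.reflect b, h.2⟩

theorem CoverableWithin.waste_le {A : Set (ℝ × ℝ)} {r : ℝ} (h : CoverableWithin A r) :
    waste A ≤ r - (volume A).toReal := by
  obtain ⟨n, hn, hn'⟩ := h
  have : (coverNumber A : ℝ) ≤ n := by exact_mod_cast Nat.sInf_le hn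
  unfold waste
  linarith

/-- The right trapezoid of height `h` with bottom edge `a`, widening upwards with slope `t` on its
right-hand side. -/
def trap (h a t : ℝ) : Set (ℝ × ℝ) := {q | 0 ≤ q.2 ∧ q.2 ≤ h ∧ 0 ≤ q.1 ∧ q.1 ≤ a + t * q.2}

theorem volume_rectangle {l w : ℝ} (hl : 0 ≤ l) (hw : 0 ≤ w) :
    (volume (rectangle l w)).toReal = l * w := by
  rw [rectangle, Measure.volume_eq_prod, Measure.prod_prod, Real.volume_Icc, Real.volume_Icc,
    ENNReal.toReal_mul, ENNReal.toReal_ofReal (by linarith), ENNReal.toReal_ofReal (by linarith)]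
  ring

theorem volume_trapezoid {h a θ : ℝ} (hh : 0 ≤ h) (ha : 0 ≤ a) (hθ : 0 ≤ Real.tan θ) :
    (volume (trapezoid h a θ)).toReal = a * h + Real.tan θ * h ^ 2 / 2 := by
  have hmeas : MeasurableSet (trapezoid h a θ) := by
    apply IsClosed.measurableSet
    unfold trapezoid
    simp only [Set.ofPred_and]
    refine (isClosed_le (by fun_prop) (by fun_prop)).inter ((isClosed_le (by fun_prop)
      (by fun_prop)).inter ((isClosed_le (by fun_prop) (by fun_prop)).inter
      (isClosed_le (by fun_prop) (by fun_prop))))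
  have hs : ∀ y : ℝ, volume ((fun x => (x, y)) ⁻¹' trapezoid h a θ) =
      (Set.Icc 0 h).indicator (fun y => ENNReal.ofReal (a + (h - y) * Real.tan θ)) y := by
    intro y
    by_cases hy : y ∈ Set.Icc 0 h
    · rw [Set.indicator_of_mem hy]
      have : (fun x => (x, y)) ⁻¹' trapezoid h a θ = Set.Icc 0 (a + (h - y) * Real.tan θ) := by
        ext x
        simp [trapezoid, hy.1, hy.2]
      rw [this, Real.volume_Icc, sub_zero]
    · rw [Set.indicator_of_notMem hy]
      have : (fun x => (x, y)) ⁻¹' trapezoid h a θ = ∅ := by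
        ext x
        simp only [trapezoid, Set.mem_preimage, Set.mem_ofPred_eq, Set.mem_empty_iff_false,
          iff_false]
        exact fun h' => hy ⟨h'.1, h'.2.1⟩
      rw [this, measure_empty]
  rw [Measure.volume_eq_prod, Measure.prod_apply_symm hmeas]
  simp only [hs]
  rw [lintegral_indicator measurableSet_Icc, ← ofReal_integral_eq_lintegral_ofReal
    (Continuous.integrableOn_Icc (by fun_prop))]
  · rw [integral_Icc_eq_integral_Ioc, ← intervalIntegral.integral_of_le hh]
    have : ∫ y in (0 : ℝ)..h, (a + (h - y) * Real.tan θ) = a * h + Real.tan θ * h ^ 2 / 2 := by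
      have hd : ∀ y ∈ Set.uIcc 0 h, HasDerivAt
          (fun y => (a + h * Real.tan θ) * y - Real.tan θ * y ^ 2 / 2)
          (a + (h - y) * Real.tan θ) y := by
        intro y _
        have := ((hasDerivAt_id y).const_mul (a + h * Real.tan θ)).sub
          (((hasDerivAt_pow 2 y).const_mul (Real.tan θ)).div_const 2)
        exact this.congr_deriv (by push_cast; ring)
      rw [intervalIntegral.integral_eq_sub_of_hasDerivAt hd
        (Continuous.intervalIntegrable (by fun_prop) _ _)]
      ring
    rw [this, ENNReal.toReal_ofReal]
    positivity
  · filter_upwards [ae_restrict_mem measurableSet_Icc] with y hy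
    have := mul_nonneg (sub_nonneg.2 hy.2) hθ
    simp only [Pi.zero_apply]
    linarith

theorem CoverableWithin.trapezoid {h a θ r : ℝ} (H : CoverableWithin (trap h a (Real.tan θ)) r) :
    CoverableWithin (trapezoid h a θ) r := by
  refine (H.reflect h).mono (fun q hq => ?_) le_rfl
  obtain ⟨h1, h2, h3, h4⟩ := hq
  exact ⟨by simpa using h2, by simpa using h1, h3, by simp only; linarith⟩

/-! ### Counting squares in a block of tilted rows over unit columns -/

/-- A region inside `[0, M) × [0, H]` is covered by `J` parallel rows tilted by `φ`, of which row
`j` has `n j` squares and reaches from the line `x = M - n j` to the right-hand boundary (`hrow`), and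
by upright columns below and above these rows. The count uses that column `i` meets `N i` of the
rows, where `∑ N i = ∑ n j`. -/
theorem coverableWithin_slanted_rows {φ H : ℝ} (hc : 0 < Real.cos φ) (hs : 0 ≤ Real.sin φ)
    {M J : ℕ} {n : ℕ → ℕ} (hn : Antitone n) (hnM : ∀ j, n j ≤ M)
    (hJ : J + M * Real.sin φ ≤ Real.cos φ * H) {D : Set (ℝ × ℝ)}
    (hD : ∀ q ∈ D, 0 ≤ q.2 ∧ q.2 ≤ H ∧ 0 ≤ q.1 ∧ q.1 < M)
    (hrow : ∀ q ∈ D, ∀ j < J, -q.1 * Real.sin φ + q.2 * Real.cos φ ≤ j + 1 →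
      q.1 * Real.cos φ + q.2 * Real.sin φ ≤ (M - n j + j * Real.sin φ) / Real.cos φ + n j) :
    CoverableWithin D (M * (H + 2 + Real.sin φ / Real.cos φ)
      - (1 / Real.cos φ - 1) * ∑ j ∈ Finset.range J, (n j : ℝ)) := by
  set c := Real.cos φ with hcdef
  set s := Real.sin φ with hsdef
  have hcs : c ^ 2 + s ^ 2 = 1 := Real.cos_sq_add_sin_sq φ
  -- `N i` is the number of rows whose tilted part reaches over the column `i ≤ x ≤ i + 1`; as `n` is
  -- antitone, these are the rows `0, …, N i - 1`
  let N : ℕ → ℕ := fun i => ((Finset.range J).filter (fun j => M ≤ i + n j)).card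
  have hNJ : ∀ i, N i ≤ J := fun i => by
    simpa using Finset.card_filter_le (Finset.range J) (fun j => M ≤ i + n j)
  have hNle : ∀ i j, j < J → ¬ M ≤ i + n j → N i ≤ j := by
    intro i j hj hij
    have : (Finset.range J).filter (fun j => M ≤ i + n j) ⊆ Finset.range j := by
      intro k hk
      rw [Finset.mem_filter] at hk
      by_contra hkj
      have := hn (not_lt.1 (fun h => hkj (Finset.mem_range.2 h)))
      omega
    simpa using Finset.card_le_card this
  have hNsum : ∑ i ∈ Finset.range M, (N i : ℝ) = ∑ j ∈ Finset.range J, (n j : ℝ) := by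
    have : ∑ i ∈ Finset.range M, N i = ∑ j ∈ Finset.range J, n j := by
      simp only [N, Finset.card_filter]
      rw [Finset.sum_comm]
      refine Finset.sum_congr rfl fun j _ => ?_
      rw [← Finset.card_filter]
      have : (Finset.range M).filter (fun i => M ≤ i + n j) = Finset.Ico (M - n j) M := by
        ext i
        simp only [Finset.mem_filter, Finset.mem_range, Finset.mem_Ico]
        omega
      have := hnM j
      simp only [*, Nat.card_Ico]
      omega
    exact_mod_cast this
  -- `R j` is the tilted part of row `j`; `B i` and `T i` are the parts of column `i` below and above
  -- the tilted rows
  let R : Fin J → Set (ℝ × ℝ) := fun j => {q | q ∈ D ∧ (j : ℝ) ≤ -q.1 * s + q.2 * c ∧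
    -q.1 * s + q.2 * c ≤ j + 1 ∧ (M : ℝ) - n j ≤ q.1}
  let B : Fin M → Set (ℝ × ℝ) := fun i => {q | (i : ℝ) ≤ q.1 ∧ q.1 ≤ i + 1 ∧ 0 ≤ q.2 ∧
    q.2 ≤ (i + 1) * (s / c)}
  let T : Fin M → Set (ℝ × ℝ) := fun i => {q | (i : ℝ) ≤ q.1 ∧ q.1 ≤ i + 1 ∧
    (N i + i * s) / c ≤ q.2 ∧ q.2 ≤ H}
  have hR : ∀ j, CoverableBy (R j) (n j) := by
    intro j
    rcases Nat.eq_zero_or_pos (n j) with h0 | h0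
    · refine (coverableBy_empty _).mono ?_
      rintro q ⟨h1, -, -, h2⟩
      have := (hD q h1).2.2.2
      rw [h0] at h2
      push_cast at h2
      linarith
    · have := coverableBy_tiltedRect φ ((M - n j + j * s) / c) j h0 one_pos
      rw [mul_one] at this
      refine this.mono ?_
      rintro q ⟨h1, h2, h3, h4⟩
      refine ⟨⟨?_, hrow q h1 j j.2 h3⟩, h2, by simpa using h3⟩
      rw [← hcdef, ← hsdef, div_le_iff₀ hc]
      have : (j : ℝ) * s ≤ (-q.1 * s + q.2 * c) * s := mul_le_mul_of_nonneg_right h2 hs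
      nlinarith
  have hB : ∀ i, CoverableBy (B i) (1 * (⌊((i : ℕ) + 1) * (s / c)⌋₊ + 1)) := by
    refine fun i => coverableBy_box i 0 one_pos (Nat.succ_pos _) ?_
    rintro q ⟨h1, h2, h3, h4⟩
    refine ⟨h1, by simpa using h2, h3, ?_⟩
    have := Nat.lt_floor_add_one (((i : ℕ) + 1 : ℝ) * (s / c))
    push_cast
    linarith
  have hT : ∀ i, CoverableBy (T i) (1 * (⌊H - (N i + (i : ℕ) * s) / c⌋₊ + 1)) := by
    refine fun i => coverableBy_box i ((N i + (i : ℕ) * s) / c) one_pos (Nat.succ_pos _) ?_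
    rintro q ⟨h1, h2, h3, h4⟩
    refine ⟨h1, by simpa using h2, h3, ?_⟩
    have := Nat.lt_floor_add_one (H - (N i + (i : ℕ) * s) / c)
    push_cast
    linarith
  have hcov := (CoverableBy.iUnion hR).union ((CoverableBy.iUnion hB).union
    (CoverableBy.iUnion hT))
  refine ⟨_, hcov.mono ?_, ?_⟩
  · intro q hq
    obtain ⟨h1, h2, h3, h4⟩ := hD q hq
    have hi : ⌊q.1⌋₊ < M := (Nat.floor_lt h3).2 h4
    have hi1 := Nat.floor_le h3
    have hi2 := (Nat.lt_floor_add_one q.1).le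
    have htop : ∀ k : ℕ, N ⌊q.1⌋₊ ≤ k → (k : ℝ) ≤ -q.1 * s + q.2 * c →
        q ∈ ⋃ i, T i := by
      intro k hk hk'
      refine Set.mem_iUnion.2 ⟨⟨_, hi⟩, hi1, hi2, ?_, h2⟩
      rw [div_le_iff₀ hc]
      have h5 : (N ⌊q.1⌋₊ : ℝ) ≤ k := by exact_mod_cast hk
      have := mul_le_mul_of_nonneg_right hi1 hs
      simp only
      linarith
    rcases lt_or_ge (-q.1 * s + q.2 * c) 0 with hv | hv
    · refine Or.inr (Or.inl (Set.mem_iUnion.2 ⟨⟨_, hi⟩, hi1, hi2, h1, ?_⟩))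
      rw [← mul_div_assoc, le_div_iff₀ hc]
      have := mul_le_mul_of_nonneg_right hi2 hs
      simp only
      linarith
    · have hj1 := Nat.floor_le hv
      have hj2 := (Nat.lt_floor_add_one (-q.1 * s + q.2 * c)).le
      by_cases hj : ⌊-q.1 * s + q.2 * c⌋₊ < J
      · by_cases hm : M ≤ ⌊q.1⌋₊ + n ⌊-q.1 * s + q.2 * c⌋₊
        · refine Or.inl (Set.mem_iUnion.2 ⟨⟨_, hj⟩, hq, hj1, hj2, ?_⟩)
          have : (M : ℝ) ≤ ⌊q.1⌋₊ + n ⌊-q.1 * s + q.2 * c⌋₊ := by exact_mod_cast hm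
          simp only
          linarith
        · exact Or.inr (Or.inr (htop _ (hNle _ _ hj hm) hj1))
      · exact Or.inr (Or.inr (htop _ ((hNJ _).trans (not_lt.1 hj)) hj1))
  -- One column costs `(i + 1) * (s / c) + 1` below and `H - (N i + i * s) / c + 1` above the rows.
  · have hcol : ∀ i ∈ Finset.range M, ((⌊((i : ℕ) + 1 : ℝ) * (s / c)⌋₊ + 1 : ℕ) : ℝ) +
        ((⌊H - (N i + (i : ℕ) * s) / c⌋₊ + 1 : ℕ) : ℝ) ≤ H + 2 + s / c - N i / c := by
      intro i hi
      have hiM : (i : ℝ) ≤ M := by exact_mod_cast (Finset.mem_range.1 hi).le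
      have h1 : (⌊((i : ℕ) + 1 : ℝ) * (s / c)⌋₊ : ℝ) ≤ (i + 1) * (s / c) :=
        Nat.floor_le (by positivity)
      have h2 : (⌊H - (N i + (i : ℕ) * s) / c⌋₊ : ℝ) ≤ H - (N i + i * s) / c := by
        apply Nat.floor_le
        rw [sub_nonneg, div_le_iff₀ hc]
        have : (N i : ℝ) ≤ J := by exact_mod_cast hNJ i
        have := mul_le_mul_of_nonneg_right hiM hs
        linarith
      have h3 : ((i : ℝ) + 1) * (s / c) - (N i + i * s) / c = s / c - N i / c := by
        field_simp
        ring
      push_cast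
      linarith
    have hsum := Finset.sum_le_sum hcol
    rw [Finset.sum_add_distrib, Finset.sum_sub_distrib, Finset.sum_const, Finset.card_range,
      nsmul_eq_mul, ← Finset.sum_div, hNsum] at hsum
    push_cast [Fin.sum_univ_eq_sum_range (fun j => (n j : ℝ)),
      Fin.sum_univ_eq_sum_range (fun i : ℕ => (⌊((i : ℕ) + 1 : ℝ) * (s / c)⌋₊ : ℝ)),
      Fin.sum_univ_eq_sum_range (fun i : ℕ => (⌊H - (N i + (i : ℕ) * s) / c⌋₊ : ℝ)),
      one_mul, Finset.sum_add_distrib] at hsum ⊢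
    simp only [Finset.sum_const, Finset.card_univ, Fintype.card_fin, Finset.card_range,
      nsmul_eq_mul] at hsum ⊢
    have : (1 / c - 1) * ∑ j ∈ Finset.range J, (n j : ℝ) =
      (∑ j ∈ Finset.range J, (n j : ℝ)) / c - ∑ j ∈ Finset.range J, (n j : ℝ) := by ring
    rw [this]
    linarith

/-! ### A slowly widening block, covered by rows in one fixed direction -/

theorem sum_range_cast_le (J : ℕ) : ∑ j ∈ Finset.range J, (j : ℝ) ≤ (J : ℝ) ^ 2 / 2 := by
  induction J with
  | zero => simp
  | succ k ih => rw [Finset.sum_range_succ]; push_cast; linarith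

/-- A trapezoid whose width stays between `M - 2` and `M` is covered with waste at most
`3 * M + 4 * H / √M`, where `q = √M`. The margin `4 / q` in `hbt` pays for the sawtooth at the ends of
the tilted rows. -/
theorem coverableWithin_block {M : ℕ} {q b t H : ℝ} (hq : 27 ≤ q) (hM : (M : ℝ) = q ^ 2)
    (ht : 0 ≤ t) (htM : 10 * t * M ≤ 1) (hH : 0 ≤ H) (hb : 0 ≤ b) (hb2 : M - b ≤ 2)
    (hbt : t * H + 4 / q ≤ M - b) :
    CoverableWithin (trap H b t) (b * H + t * H ^ 2 / 2 + 3 * M + 4 * H / q) := by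
  have hq0 : 0 < q := by linarith
  obtain ⟨δ, hδ⟩ : ∃ δ, δ = 1 / q := ⟨_, rfl⟩
  have hδq : δ * q = 1 := by rw [hδ]; field_simp
  have hδ0 : 0 < δ := by rw [hδ]; positivity
  have hδ1 : δ ≤ 1 / 27 := by rw [hδ]; exact one_div_le_one_div_of_le (by norm_num) hq
  have hMδ : M * δ ^ 2 = 1 := by rw [hM]; linear_combination (δ * q + 1) * hδq
  have hMδ' : M * δ = q := by rw [hM]; linear_combination q * hδq
  rw [show 4 / q = 4 * δ by rw [hδ]; ring] at hbt
  rw [show 4 * H / q = 4 * δ * H by rw [hδ]; ring]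
  have hMq : 27 * q ≤ M := by
    rw [hM, sq]; exact mul_le_mul_of_nonneg_right hq hq0.le
  have hM0 : (0 : ℝ) < M := by linarith
  have htH0 : 0 ≤ t * H := by positivity
  have htH2 : t * H ≤ 2 := by linarith
  have htδ : 10 * t ≤ δ ^ 2 := by
    have := mul_le_mul_of_nonneg_right htM (sq_nonneg δ)
    have h2 : 10 * t * M * δ ^ 2 = 10 * t := by linear_combination 10 * t * hMδ
    linarith
  have hδδ : δ ^ 2 ≤ δ / 27 := by
    have := mul_le_mul_of_nonneg_right hδ1 hδ0.le
    linarith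
  have hδ2 : δ ^ 2 ≤ 1 / 729 := by linarith
  -- the common direction of the tilted rows
  obtain ⟨c, hc⟩ : ∃ c, c = 1 - 2 * δ ^ 2 := ⟨_, rfl⟩
  have hc1 : c ≤ 1 := by linarith [sq_nonneg δ]
  have hc99 : 99 / 100 ≤ c := by linarith
  have hc0 : 0 < c := by linarith
  obtain ⟨φ, hφ⟩ : ∃ φ, φ = Real.arccos c := ⟨_, rfl⟩
  have hcos : Real.cos φ = c := by rw [hφ]; exact Real.cos_arccos (by linarith) hc1
  obtain ⟨s, hs⟩ : ∃ s, s = Real.sin φ := ⟨_, rfl⟩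
  have hs0 : 0 ≤ s := by rw [hs, hφ, Real.sin_arccos]; positivity
  have hcs : c ^ 2 + s ^ 2 = 1 := by rw [hs, ← hcos]; exact Real.cos_sq_add_sin_sq φ
  have hs2 : s ≤ 2 * δ := by
    apply le_of_sq_le_sq _ (by positivity)
    rw [hc] at hcs
    linarith [sq_nonneg (δ ^ 2)]
  have hMs : M * s ≤ 2 * q := by
    have := mul_le_mul_of_nonneg_left hs2 hM0.le
    linarith
  have hDM : ∀ x ∈ trap H b t, 0 ≤ x.2 ∧ x.2 ≤ H ∧ 0 ≤ x.1 ∧ x.1 < M := by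
    rintro x ⟨h1, h2, h3, h4⟩
    have := mul_le_mul_of_nonneg_left h2 ht
    exact ⟨h1, h2, h3, by linarith⟩
  -- If not even the slope of the first row fits below height `H`, upright columns suffice.
  rcases lt_or_ge (c * H) (M * s) with hsmall | hlarge
  · have hHq : H ≤ 21 / 10 * q := by
      have := mul_le_mul_of_nonneg_right hc99 hH
      linarith
    refine ⟨M * (⌊H⌋₊ + 1), coverableBy_box 0 0 (by exact_mod_cast hM0) (Nat.succ_pos _) ?_, ?_⟩
    · intro x hx
      obtain ⟨h1, h2, h3, h4⟩ := hDM x hx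
      have := (Nat.lt_floor_add_one H).le
      push_cast
      exact ⟨h3, by linarith, h1, by linarith⟩
    · have h1 := mul_le_mul_of_nonneg_left (Nat.floor_le hH) hM0.le
      have h2 := mul_le_mul_of_nonneg_right hb2 hH
      have h3 : 0 ≤ t * H ^ 2 := by positivity
      have h4 : 0 ≤ δ * H := by positivity
      push_cast
      linarith
  -- In the frame of the rows, with coordinates `u` and `v`, the boundary `x ≤ b + t * y` becomes
  -- `κ * u ≤ b + (s + t * c) * v`.
  obtain ⟨κ, hκ⟩ : ∃ κ, κ = c - t * s := ⟨_, rfl⟩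
  have hts0 : 0 ≤ t * s := by positivity
  have hts : t * s ≤ δ ^ 2 / 5 * δ := by
    have := mul_le_mul htδ hs2 hs0 (sq_nonneg δ)
    linarith
  have hδ3 : δ ^ 2 * δ ≤ 1 / 729 * δ := mul_le_mul_of_nonneg_right hδ2 hδ0.le
  have hκ98 : 98 / 100 ≤ κ := by linarith
  have hκ0 : 0 < κ := by linarith
  obtain ⟨ε, hε⟩ : ∃ ε, ε = t * s / κ := ⟨_, rfl⟩
  have hε0 : 0 ≤ ε := by rw [hε]; positivity
  have hε1 : ε ≤ 21 / 100 * δ ^ 2 * δ := by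
    rw [hε, div_le_iff₀ hκ0]
    have := mul_le_mul_of_nonneg_left hκ98 (show 0 ≤ δ ^ 2 * δ by positivity)
    linarith
  have hε2 : ε ≤ δ / 1000 := by linarith
  have hcκ : c / κ = 1 + ε := by
    rw [hε]
    field_simp
    rw [hκ]
    ring
  obtain ⟨G, hG⟩ : ∃ G, G = c * (b + s + t * c) / κ := ⟨_, rfl⟩
  have hG' : G = (1 + ε) * (b + s + t * c) := by rw [hG, ← hcκ]; ring
  have htc0 : 0 ≤ t * c := by positivity
  have htc : t * c ≤ t := mul_le_of_le_one_right ht hc1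
  have hbM : b + s + t * c ≤ 101 / 100 * M := by linarith
  have hG1 : b ≤ G := by
    rw [hG']
    linarith [mul_nonneg hε0 (show 0 ≤ b + s + t * c by positivity)]
  have hG2 : G ≤ b + 23 / 10 * δ := by
    have h1 : ε * (b + s + t * c) ≤ (21 / 100 * δ ^ 2 * δ) * (101 / 100 * M) :=
      mul_le_mul hε1 hbM (by positivity) (by positivity)
    have h2 : (21 / 100 * δ ^ 2 * δ) * (101 / 100 * M) = 2121 / 10000 * δ := by
      linear_combination 2121 / 10000 * δ * hMδ
    rw [hG']
    linarith
  -- `E j` is the excess of `M` over the width that row `j` has to cover; each tilted square uses up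
  -- `1 - c` of it.
  let E : ℕ → ℝ := fun j => M - G - j * (t / κ)
  let n : ℕ → ℕ := fun j => ⌊E j * (M / 2)⌋₊
  let J : ℕ := ⌊c * H - M * s⌋₊
  have hJ : (J : ℝ) ≤ c * H - M * s := Nat.floor_le (by linarith)
  have hJ' : c * H - M * s - 1 ≤ J := by
    have := Nat.lt_floor_add_one (c * H - M * s)
    linarith
  have hJH : (J : ℝ) ≤ c * H := by linarith [mul_nonneg hM0.le hs0]
  have htκ : 0 ≤ t / κ := by positivity
  have hEanti : Antitone E := by
    intro i j hij
    have : (i : ℝ) ≤ j := by exact_mod_cast hij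
    have := mul_le_mul_of_nonneg_right this htκ
    simp only [E]
    linarith
  have hE0 : ∀ j < J, 0 ≤ E j := by
    intro j hj
    have h1 : (j : ℝ) ≤ c * H := le_trans (by exact_mod_cast hj.le) hJH
    have h2 := mul_le_mul_of_nonneg_right h1 htκ
    have h3 : c * H * (t / κ) = t * H * (1 + ε) := by rw [← hcκ]; ring
    have h4 := mul_le_mul_of_nonneg_right htH2 hε0
    simp only [E]
    linarith
  have hE2 : ∀ j, E j ≤ 2 := by
    intro j
    have : 0 ≤ j * (t / κ) := by positivity
    simp only [E]
    linarith
  have hn : Antitone n := fun i j hij =>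
    Nat.floor_mono (mul_le_mul_of_nonneg_right (hEanti hij) (by positivity))
  have hnM : ∀ j, n j ≤ M := by
    intro j
    apply Nat.floor_le_of_le
    linarith [mul_le_mul_of_nonneg_right (hE2 j) (show 0 ≤ (M : ℝ) / 2 by positivity)]
  have h1c : (1 - c) * M = 2 := by rw [hc]; linear_combination 2 * hMδ
  have hnE : ∀ j < J, n j * (1 - c) ≤ E j := by
    intro j hj
    have h1 : (n j : ℝ) ≤ E j * (M / 2) :=
      Nat.floor_le (mul_nonneg (hE0 j hj) (by positivity))
    have h2 := mul_le_mul_of_nonneg_right h1 (sub_nonneg.2 hc1)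
    have h3 : E j * (M / 2) * (1 - c) = E j := by linear_combination E j / 2 * h1c
    linarith
  have hnE' : ∀ j, E j - (1 - c) ≤ n j * (1 - c) := by
    intro j
    have h1 : E j * (M / 2) ≤ n j + 1 := (Nat.lt_floor_add_one _).le
    have h2 := mul_le_mul_of_nonneg_right h1 (sub_nonneg.2 hc1)
    have h3 : E j * (M / 2) * (1 - c) = E j := by linear_combination E j / 2 * h1c
    linarith
  have hcov := coverableWithin_slanted_rows (φ := φ) (H := H) (D := trap H b t) (J := J)
    (by rw [hcos]; exact hc0) (by rw [← hs]; exact hs0) hn hnM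
    (by rw [hcos, ← hs]; linarith) hDM (by
      rintro ⟨x, y⟩ ⟨-, -, -, hx⟩ j hj hv
      rw [hcos, ← hs] at hv ⊢
      simp only at hx hv ⊢
      have h1 : (x * c + y * s) * κ ≤ b + (j + 1) * (s + t * c) := by
        have h2 : (x * c + y * s) * κ = x - t * y + (-x * s + y * c) * (s + t * c) := by
          rw [hκ]
          linear_combination (x - t * y) * hcs
        have h3 := mul_le_mul_of_nonneg_right hv (show 0 ≤ s + t * c by positivity)
        linarith
      have h2 : x * c + y * s ≤ (b + (j + 1) * (s + t * c)) / κ := by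
        rwa [le_div_iff₀ hκ0]
      have h3 := hnE j hj
      have h4 : E j = M + j * s - c * ((b + (j + 1) * (s + t * c)) / κ) := by
        simp only [E, hG]
        field_simp
        rw [hκ]
        linear_combination (j : ℝ) * t * hcs
      rw [← sub_le_iff_le_add, le_div_iff₀ hc0]
      have h5 := mul_le_mul_of_nonneg_left h2 hc0.le
      linarith)
  rw [hcos, ← hs] at hcov
  refine hcov.mono subset_rfl ?_
  have hsum : J * (M - G - (1 - c)) - (J : ℝ) ^ 2 / 2 * (t / κ) ≤
      (1 - c) * ∑ j ∈ Finset.range J, (n j : ℝ) := by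
    have h1 := Finset.sum_le_sum fun j (_ : j ∈ Finset.range J) => hnE' j
    rw [← Finset.sum_mul] at h1
    simp only [E, Finset.sum_sub_distrib, Finset.sum_const, Finset.card_range, nsmul_eq_mul,
      ← Finset.sum_mul] at h1
    have h2 := mul_le_mul_of_nonneg_right (sum_range_cast_le J) htκ
    linarith
  have hlow : H * (M - b) - 241 / 100 * δ * H - 42 / 10 * q - t * H ^ 2 / 2 ≤
      (1 / c - 1) * ∑ j ∈ Finset.range J, (n j : ℝ) := by
    have h0 : (1 / c - 1) * ∑ j ∈ Finset.range J, (n j : ℝ) =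
        ((1 - c) * ∑ j ∈ Finset.range J, (n j : ℝ)) / c := by field_simp
    rw [h0, le_div_iff₀ hc0]
    refine le_trans ?_ hsum
    have hg0 : 0 ≤ M - b - 24 / 10 * δ := by linarith
    have h1 : J * (M - b - 24 / 10 * δ) ≤ J * (M - G - (1 - c)) := by
      apply mul_le_mul_of_nonneg_left _ (Nat.cast_nonneg J)
      linarith
    have h2 : (c * H - 2 * q - 1) * (M - b - 24 / 10 * δ) ≤ J * (M - b - 24 / 10 * δ) :=
      mul_le_mul_of_nonneg_right (by linarith) hg0
    have h3 : (J : ℝ) ^ 2 / 2 * (t / κ) ≤ (t * H ^ 2 / 2 + δ * H / 1000) * c := by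
      have h4 : (J : ℝ) ^ 2 ≤ (c * H) ^ 2 := pow_le_pow_left₀ (Nat.cast_nonneg J) hJH 2
      have h5 := mul_le_mul_of_nonneg_right h4 htκ
      have h6 : (c * H) ^ 2 * (t / κ) = (t * H ^ 2 + t * H * ε * H) * c := by
        have : (c * H) ^ 2 * (t / κ) = c * H ^ 2 * t * (c / κ) := by ring
        rw [this, hcκ]
        ring
      have h7 : t * H * ε * H * c ≤ 2 * (δ / 1000) * H * c := by gcongr
      linarith
    have h8 : (2 * q + 1) * (M - b - 24 / 10 * δ) ≤ (2 * q + 1) * 2 :=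
      mul_le_mul_of_nonneg_left (by linarith) (by linarith)
    have h9 : 0 ≤ δ * H * c := by positivity
    have h10 : 42 / 10 * q * (99 / 100) ≤ 42 / 10 * q * c := by gcongr
    linarith
  have hMsc : M * (s / c) ≤ 21 / 10 * q := by
    rw [← mul_div_assoc, div_le_iff₀ hc0]
    linarith [mul_le_mul_of_nonneg_left hc99 hq0.le]
  have h11 : 0 ≤ δ * H := by positivity
  linarith

/-! ### Slabs and tall trapezoids -/

/-- A trapezoid that is at least `M` wide is covered by full columns of height `N ≥ H` and a
block of width about `M`. The last term vanishes if the height `H = N` is integral. -/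
theorem coverableWithin_slab {M N : ℕ} {q a t H : ℝ} (hq : 27 ≤ q) (hM : (M : ℝ) = q ^ 2)
    (ht : 0 ≤ t) (htM : 10 * t * M ≤ 1) (hH : 0 < H) (hHN : H ≤ N) (ha : M ≤ a)
    (htH : t * H + 4 / q ≤ 1) :
    CoverableWithin (trap H a t)
      (a * H + t * H ^ 2 / 2 + (3 * M + 4 * H / q) + (a - M + 2) * (N - H)) := by
  have hq4 : 0 < 4 / q := by positivity
  have htH0 : 0 ≤ t * H := by positivity
  -- `m` full columns leave a block whose width `a - m` satisfies the two conditions of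
  -- `coverableWithin_block`, which allow for a range of length at least `1`.
  obtain ⟨m, hm⟩ : ∃ m, m = ⌈a - M + (t * H + 4 / q)⌉₊ := ⟨_, rfl⟩
  have hm1 : a - M + (t * H + 4 / q) ≤ m := by rw [hm]; exact Nat.le_ceil _
  have hm2 : (m : ℝ) < a - M + (t * H + 4 / q) + 1 := by
    rw [hm]; exact Nat.ceil_lt_add_one (by linarith)
  have hm0 : 0 < m := by rw [hm]; exact Nat.ceil_pos.2 (by linarith)
  have hN0 : 0 < N := by exact_mod_cast hH.trans_le hHN
  have hM27 : (729 : ℝ) ≤ M := by rw [hM]; nlinarith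
  have hblock := coverableWithin_block (b := a - m) (H := H) hq hM ht htM hH.le (by linarith)
    (by linarith) (by linarith)
  have hbox : CoverableWithin {x : ℝ × ℝ | 0 ≤ x.1 ∧ x.1 ≤ m ∧ 0 ≤ x.2 ∧ x.2 ≤ H}
      ((m * N : ℕ) : ℝ) :=
    ⟨_, coverableBy_box 0 0 hm0 hN0 fun x hx => ⟨hx.1, by simpa using hx.2.1, hx.2.2.1, by
      have := hx.2.2.2
      linarith⟩, le_rfl⟩
  refine (hbox.union (hblock.translate m 0)).mono ?_ ?_
  · rintro x ⟨h1, h2, h3, h4⟩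
    rcases le_total x.1 m with h | h
    · exact Or.inl ⟨h3, h, h1, h2⟩
    · exact Or.inr ⟨by simpa using h1, by simpa using h2, by simpa using h,
        by simp only [sub_zero]; linarith⟩
  · have : (m : ℝ) * (N - H) ≤ (a - M + 2) * (N - H) :=
      mul_le_mul_of_nonneg_right (by linarith) (by linarith)
    push_cast
    linarith

/-- `k` slabs of the integral height `H` on top of each other. The topmost edge is left out, so
that nothing remains to be covered for `k = 0`. -/
theorem coverableWithin_stacked_slabs {M H : ℕ} {q a t : ℝ} (hq : 27 ≤ q)
    (hM : (M : ℝ) = q ^ 2) (ht : 0 ≤ t) (htM : 10 * t * M ≤ 1) (hH : 0 < H) (ha : M ≤ a)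
    (htH : t * H + 4 / q ≤ 1) (k : ℕ) :
    CoverableWithin {x | x ∈ trap (k * H) a t ∧ x.2 < k * H}
      (a * (k * H) + t * (k * H : ℝ) ^ 2 / 2 + k * (3 * M + 4 * H / q)) := by
  induction k with
  | zero =>
    refine ⟨0, (coverableBy_empty 0).mono ?_, by simp⟩
    rintro x ⟨hx, h⟩
    have := hx.1
    simp only [Nat.cast_zero, zero_mul] at h
    linarith
  | succ k ih =>
    have h0 : 0 ≤ t * (k * H) := by positivity
    have hs := coverableWithin_slab (N := H) (a := a + t * (k * H)) (H := H) hq hM ht htM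
      (by exact_mod_cast hH) le_rfl (by linarith) htH
    refine (ih.union (hs.translate 0 (k * H))).mono ?_ ?_
    · rintro x ⟨⟨h1, h2, h3, h4⟩, h5⟩
      push_cast at h2
      rcases lt_or_ge x.2 (k * H) with h | h
      · exact Or.inl ⟨⟨h1, h.le, h3, h4⟩, h⟩
      · exact Or.inr ⟨by simpa using h, by simp only; linarith, by simpa using h3,
          by simp only [sub_zero]; linarith⟩
    · push_cast
      linarith

/-- Tall trapezoids of height `r ^ 6` waste at most `11 * r ^ 5`. -/
theorem coverableWithin_trap {r a t : ℝ} (hr : 27 ≤ r) (ht : 0 ≤ t) (htr : t * r ^ 3 ≤ 71 / 50)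
    (ha1 : r ^ 2 + 1 ≤ a) (ha2 : a ≤ 3 * r ^ 3) :
    CoverableWithin (trap (r ^ 6) a t) (a * r ^ 6 + t * (r ^ 6) ^ 2 / 2 + 11 * r ^ 5) := by
  have hr0 : 0 < r := by linarith
  obtain ⟨M, hMdef⟩ : ∃ M, M = ⌈r ^ 2⌉₊ := ⟨_, rfl⟩
  have hM1 : r ^ 2 ≤ M := by rw [hMdef]; exact Nat.le_ceil _
  have hM2 : (M : ℝ) ≤ r ^ 2 + 1 := by
    rw [hMdef]; exact (Nat.ceil_lt_add_one (by positivity)).le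
  obtain ⟨q, hqdef⟩ : ∃ q, q = √(M : ℝ) := ⟨_, rfl⟩
  have hM : (M : ℝ) = q ^ 2 := by rw [hqdef, Real.sq_sqrt (Nat.cast_nonneg _)]
  have hqr : r ≤ q := by rw [hqdef]; exact Real.le_sqrt_of_sq_le hM1
  have hq : 27 ≤ q := hr.trans hqr
  have hr2 : 27 * r ≤ r ^ 2 := by rw [sq]; exact mul_le_mul_of_nonneg_right hr hr0.le
  have hr3 : 27 * r ^ 2 ≤ r ^ 3 := by
    linarith [mul_le_mul_of_nonneg_right hr (sq_nonneg r)]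
  have hr5 : 729 * r ^ 3 ≤ r ^ 5 := by
    have := mul_le_mul_of_nonneg_right (show 729 ≤ r ^ 2 by linarith)
      (show 0 ≤ r ^ 3 by positivity)
    linarith
  obtain ⟨H, hHdef⟩ : ∃ H, H = ⌊r ^ 3 / 2⌋₊ := ⟨_, rfl⟩
  have hH1 : (H : ℝ) ≤ r ^ 3 / 2 := by rw [hHdef]; exact Nat.floor_le (by positivity)
  have hH2 : r ^ 3 / 2 - 1 < H := by
    rw [hHdef]; linarith [Nat.lt_floor_add_one (r ^ 3 / 2)]
  have hH0' : (0 : ℝ) < H := by linarith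
  have hH0 : 0 < H := by exact_mod_cast hH0'
  have hq4 : 4 / q ≤ 4 / 27 := by gcongr
  have htH' : t * H ≤ 71 / 100 := by
    linarith [mul_le_mul_of_nonneg_left hH1 ht]
  have htM : 10 * t * M ≤ 1 := by
    have h1 : (M : ℝ) ≤ r ^ 3 / 20 := by linarith
    linarith [mul_le_mul_of_nonneg_left h1 ht]
  have haM : (M : ℝ) ≤ a := hM2.trans ha1
  have hHq : 4 * H / q ≤ 2 * r ^ 2 := by
    rw [div_le_iff₀ (by linarith)]
    linarith [mul_le_mul_of_nonneg_left hqr (sq_nonneg r)]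
  -- `K` slabs of the integral height `H`, and a last one of height at most `H`
  obtain ⟨K, hK1, hK2⟩ : ∃ K : ℕ, K * (H : ℝ) < r ^ 6 ∧ r ^ 6 ≤ (K + 1) * (H : ℝ) := by
    have hpos : 0 < r ^ 6 / H := by positivity
    refine ⟨⌈r ^ 6 / (H : ℝ)⌉₊ - 1, ?_, ?_⟩
    · rw [← lt_div_iff₀ hH0']
      exact Nat.lt_ceil.1 (Nat.sub_lt (Nat.ceil_pos.2 hpos) one_pos)
    · rw [← div_le_iff₀ hH0', ← Nat.cast_add_one, Nat.sub_add_cancel (Nat.ceil_pos.2 hpos)]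
      exact Nat.le_ceil _
  obtain ⟨ρ, hρ⟩ : ∃ ρ, ρ = r ^ 6 - K * H := ⟨_, rfl⟩
  have hKt : 0 ≤ t * (K * H) := by positivity
  have hKt2 : t * (K * H) ≤ 71 / 50 * r ^ 3 := by
    have h1 := mul_le_mul_of_nonneg_left hK1.le ht
    have h2 := mul_le_mul_of_nonneg_right htr (show 0 ≤ r ^ 3 by positivity)
    linarith
  have hstack := coverableWithin_stacked_slabs hq hM ht htM hH0 haM (by linarith) K
  have hlast := coverableWithin_slab (N := ⌈ρ⌉₊) (a := a + t * (K * H)) (H := ρ) hq hM ht htM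
    (by linarith) (Nat.le_ceil _) (by linarith) (by
      have : ρ ≤ H := by linarith
      linarith [mul_le_mul_of_nonneg_left this ht])
  refine (hstack.union (hlast.translate 0 (K * H))).mono ?_ ?_
  · rintro x ⟨h1, h2, h3, h4⟩
    rcases lt_or_ge x.2 (K * H) with h | h
    · exact Or.inl ⟨⟨h1, h.le, h3, h4⟩, h⟩
    · exact Or.inr ⟨by simpa using h, by simp only; linarith, by simpa using h3,
        by simp only [sub_zero]; linarith⟩
  · have h1 : (a + t * (K * H) - M + 2) * (⌈ρ⌉₊ - ρ) ≤ (5 * r ^ 3) * 1 := by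
      have := Nat.ceil_lt_add_one (show 0 ≤ ρ by linarith)
      have := Nat.le_ceil ρ
      refine mul_le_mul ?_ (by linarith) (by linarith) (by positivity)
      linarith
    have h2 : (K : ℝ) ≤ 2 * r ^ 3 + 5 := by
      by_contra! h
      have h3 := mul_le_mul h.le hH2.le (by linarith) (Nat.cast_nonneg K)
      linarith
    have h3 : 4 * ρ / q ≤ 4 * H / q := by
      gcongr
      linarith
    have h4 : (K + 1) * (3 * M + 4 * H / q) ≤ (2 * r ^ 3 + 6) * (5 * r ^ 2 + 3) :=
      mul_le_mul (by linarith) (by linarith) (by positivity) (by positivity)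
    have h5 : a * (K * H) + t * (K * H : ℝ) ^ 2 / 2 +
        ((a + t * (K * H)) * ρ + t * ρ ^ 2 / 2) = a * r ^ 6 + t * (r ^ 6) ^ 2 / 2 := by
      rw [hρ]
      ring
    linarith

/-! ### Bands and rectangles -/

/-- Rows of `n` unit squares, tilted by `φ`, that fit exactly into a vertical band of width `w`. -/
theorem exists_row_angle {w : ℝ} (hw : 1 ≤ w) : ∃ (n : ℕ) (φ : ℝ), 0 < n ∧
    n * Real.cos φ - Real.sin φ = w ∧ 0 ≤ Real.sin φ ∧ w - 1 ≤ Real.cos φ * w ∧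
    Real.sin φ ^ 2 * w ≤ 2 := by
  obtain ⟨n, hn⟩ : ∃ n, n = ⌊w⌋₊ + 1 := ⟨_, rfl⟩
  have hn1 : w < n := by rw [hn]; push_cast; exact Nat.lt_floor_add_one w
  have hn2 : (n : ℝ) ≤ w + 1 := by
    rw [hn]; push_cast; linarith [Nat.floor_le (show 0 ≤ w by linarith)]
  have hivt := intermediate_value_Icc' (f := fun φ => n * Real.cos φ - Real.sin φ)
    (show (0 : ℝ) ≤ Real.pi / 2 by positivity) (by fun_prop)
  obtain ⟨φ, ⟨hφ0, hφ1⟩, hφ⟩ := hivt (show w ∈ _ by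
    simp only [Real.cos_pi_div_two, Real.sin_pi_div_two, Real.cos_zero, Real.sin_zero]
    constructor <;> linarith)
  simp only at hφ
  have hs : 0 ≤ Real.sin φ := Real.sin_nonneg_of_nonneg_of_le_pi hφ0 (by linarith [Real.pi_pos])
  have hc1 := Real.cos_le_one φ
  have hcs := Real.cos_sq_add_sin_sq φ
  have hc0 : 0 ≤ Real.cos φ := Real.cos_nonneg_of_neg_pi_div_two_le_of_le
    (by linarith [Real.pi_pos]) hφ1
  have h1 := mul_le_mul_of_nonneg_right hn2 hc0
  have hcw : w - 1 ≤ Real.cos φ * w := by linarith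
  refine ⟨n, φ, by rw [hn]; exact Nat.succ_pos _, hφ, hs, hcw, ?_⟩
  have hs2 : Real.sin φ ^ 2 = (1 - Real.cos φ) * (1 + Real.cos φ) := by linear_combination hcs
  rw [hs2]
  have h2 : (1 - Real.cos φ) * w ≤ 1 := by linarith
  have h3 := mul_le_mul h2 (show 1 + Real.cos φ ≤ 2 by linarith) (by linarith) zero_le_one
  linarith

/-- A vertical band of width `w` is cut into `k` tilted rows and two end trapezoids, whose shorter
sides are `l` at the bottom and some `l' ∈ [l, l + 1 / cos φ]` at the top, since `k` is an integer. -/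
theorem coverableWithin_band_of_angle {n : ℕ} {φ w L l e : ℝ} (hn : 0 < n)
    (hc : 0 < Real.cos φ) (hs : 0 ≤ Real.sin φ) (hw : n * Real.cos φ - Real.sin φ = w)
    (hw0 : 0 ≤ w) (hl : 0 ≤ l) (hL : 2 * l + Real.sin φ / Real.cos φ * w ≤ L)
    (hend : ∀ l', l ≤ l' → l' ≤ l + 1 / Real.cos φ →
      CoverableWithin (trap w l' (Real.sin φ / Real.cos φ))
        (l' * w + Real.sin φ / Real.cos φ * w ^ 2 / 2 + e)) :
    CoverableWithin (rectangle w L) (w * L + 2 * e + L * Real.sin φ) := by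
  set c := Real.cos φ with hcdef
  set s := Real.sin φ with hsdef
  have hcs : c ^ 2 + s ^ 2 = 1 := Real.cos_sq_add_sin_sq φ
  obtain ⟨k, hk⟩ : ∃ k, k = ⌊c * (L - 2 * l - s / c * w)⌋₊ := ⟨_, rfl⟩
  have hk1 : (k : ℝ) ≤ c * (L - 2 * l - s / c * w) := by
    rw [hk]; exact Nat.floor_le (mul_nonneg hc.le (by linarith))
  have hk2 : c * (L - 2 * l - s / c * w) ≤ k + 1 := by
    rw [hk]; exact (Nat.lt_floor_add_one _).le
  obtain ⟨l', hl'⟩ : ∃ l', l' = L - l - s / c * w - k / c := ⟨_, rfl⟩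
  have hl1 : l ≤ l' := by
    have : k / c ≤ L - 2 * l - s / c * w := by rwa [div_le_iff₀' hc]
    linarith
  have hl2 : l' ≤ l + 1 / c := by
    have : L - 2 * l - s / c * w ≤ (k + 1) / c := by rwa [le_div_iff₀' hc]
    rw [add_div] at this
    linarith
  have hrows : CoverableBy (⋃ j : Fin k, tiltedRect φ (l * s + j * s / c) (l * c + j) n (1 : ℕ))
      (∑ _j : Fin k, n * 1) :=
    CoverableBy.iUnion fun j => coverableBy_tiltedRect _ _ _ hn one_pos
  have hlow := (hend l le_rfl (by linarith [one_div_pos.2 hc])).swap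
  have hhigh := ((((hend l' hl1 hl2).swap.reflect L).swap.reflect w).swap)
  refine ((CoverableWithin.union ⟨_, hrows, le_rfl⟩ hlow).union hhigh).mono ?_ ?_
  · rintro ⟨x, y⟩ ⟨⟨h1, h2⟩, h3, h4⟩
    simp only at h1 h2 h3 h4
    rcases le_total y (l + s / c * x) with h | h
    · exact Or.inl (Or.inr ⟨h1, h2, h3, h⟩)
    rcases le_or_gt (l + s / c * x + k / c) y with h' | h'
    · refine Or.inr ⟨?_, ?_, ?_, ?_⟩ <;> simp only <;> linarith
    · refine Or.inl (Or.inl ?_)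
      obtain ⟨v, hv⟩ : ∃ v, v = -x * s + (y - l) * c := ⟨_, rfl⟩
      have hsx : s / c * x * c = s * x := by field_simp
      have hv0 : 0 ≤ v := by
        have := mul_le_mul_of_nonneg_right h hc.le
        linarith
      have hvk : v < k := by
        have := mul_lt_mul_of_pos_right h' hc
        have h5 : k / c * c = k := by field_simp
        linarith
      have hj1 := Nat.floor_le hv0
      have hj2 := (Nat.lt_floor_add_one v).le
      refine Set.mem_iUnion.2 ⟨⟨⌊v⌋₊, (Nat.floor_lt hv0).2 hvk⟩, ⟨?_, ?_⟩, ?_, ?_⟩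
      · simp only [← hcdef, ← hsdef]
        have : ⌊v⌋₊ * s / c ≤ x * c + (y - l) * s := by
          rw [div_le_iff₀ hc]
          have h5 : (x * c + (y - l) * s) * c = x + v * s := by
            rw [hv]; linear_combination x * hcs
          rw [h5]
          linarith [mul_le_mul_of_nonneg_right hj1 hs]
        linarith
      · simp only [← hcdef, ← hsdef]
        have : x * c + (y - l) * s ≤ ⌊v⌋₊ * s / c + n := by
          rw [← sub_le_iff_le_add, le_div_iff₀ hc]
          have h5 : (x * c + (y - l) * s - n) * c = x + v * s - n * c := by
            rw [hv]; linear_combination x * hcs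
          rw [h5]
          linarith [mul_le_mul_of_nonneg_right hj2 hs]
        linarith
      · simp only [← hcdef, ← hsdef]
        linarith
      · simp only [← hcdef, ← hsdef]
        push_cast
        linarith
  · simp only [mul_one, Finset.sum_const, Finset.card_univ, Fintype.card_fin, smul_eq_mul]
    push_cast
    have h1 : k * n = k / c * w + k / c * s := by
      rw [← hw]; field_simp; ring
    have h2 : k / c * s ≤ L * s := by
      refine mul_le_mul_of_nonneg_right ?_ hs
      have h3 : 0 ≤ s / c * w := by positivity
      linarith
    rw [h1]
    have : l' * w = L * w - l * w - s / c * w ^ 2 - k / c * w := by rw [hl']; ring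
    linarith

/-- A band of width `w` is covered with waste `L * σ` for its tilted rows, where `σ ≥ √(2 / w)`, and
waste `e` for each end trapezoid. The slope `t` of the end trapezoids is about `√(2 / w)`. -/
theorem coverableWithin_band {w L l e σ : ℝ} (hw : 40 ≤ w) (hl : 0 ≤ l)
    (hL : 2 * l + 2 * √w ≤ L) (hσ : 0 ≤ σ) (hσw : 2 ≤ σ ^ 2 * w)
    (hend : ∀ l' t, 0 ≤ t → t ^ 2 * (w - 1) ^ 2 ≤ 2 * w → l ≤ l' → l' ≤ l + 2 →
      CoverableWithin (trap w l' t) (l' * w + t * w ^ 2 / 2 + e)) :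
    CoverableWithin (rectangle w L) (w * L + 2 * e + L * σ) := by
  obtain ⟨n, φ, hn, hnw, hs, hc, hs2⟩ := exists_row_angle (show 1 ≤ w by linarith)
  have hw0 : 0 < w := by linarith
  have hc12 : 1 / 2 ≤ Real.cos φ := by
    by_contra! h
    linarith [mul_lt_mul_of_pos_right h hw0]
  have hc0 : 0 < Real.cos φ := by linarith
  obtain ⟨t, ht⟩ : ∃ t, t = Real.sin φ / Real.cos φ := ⟨_, rfl⟩
  have ht0 : 0 ≤ t := by rw [ht]; positivity
  have hts : t * Real.cos φ = Real.sin φ := by rw [ht]; field_simp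
  have htw : t ^ 2 * (w - 1) ^ 2 ≤ 2 * w := by
    have h1 : (w - 1) ^ 2 ≤ (Real.cos φ * w) ^ 2 := pow_le_pow_left₀ (by linarith) hc 2
    have h2 : t ^ 2 * (Real.cos φ * w) ^ 2 = Real.sin φ ^ 2 * w * w := by rw [← hts]; ring
    calc t ^ 2 * (w - 1) ^ 2 ≤ t ^ 2 * (Real.cos φ * w) ^ 2 := by gcongr
      _ = Real.sin φ ^ 2 * w * w := h2
      _ ≤ 2 * w := by gcongr
  have htw2 : t * w ≤ 2 * √w := by
    apply le_of_sq_le_sq _ (by positivity)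
    rw [mul_pow, mul_pow, Real.sq_sqrt hw0.le]
    have h1 : (39 / 40 * w) ^ 2 ≤ (w - 1) ^ 2 :=
      pow_le_pow_left₀ (by linarith) (by linarith) 2
    have h2 := mul_le_mul_of_nonneg_left h1 (sq_nonneg t)
    linarith
  have hsσ : Real.sin φ ≤ σ := by
    apply le_of_sq_le_sq _ hσ
    exact le_of_mul_le_mul_right (hs2.trans hσw) hw0
  have hc2 : 1 / Real.cos φ ≤ 2 := by
    rw [div_le_iff₀ hc0]; linarith
  refine (coverableWithin_band_of_angle (L := L) (l := l) (e := e) hn hc0 hs hnw hw0.le hl ?_ ?_).mono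
    subset_rfl ?_
  · rw [← ht]; linarith
  · intro l' h1 h2
    rw [← ht]
    exact hend l' t ht0 htw h1 (by linarith)
  · have : 0 ≤ L := by linarith [Real.sqrt_nonneg w]
    linarith [mul_le_mul_of_nonneg_left hsσ this]

/-- A rectangle is an integral rectangle, a vertical band on its right and a horizontal band above
it, both of width between `y` and `y + 1`. -/
theorem coverableWithin_rectangle_of_ends {x x' y l e σ : ℝ} (hy : 40 ≤ y) (hyx' : y ≤ x')
    (hl : 0 ≤ l) (hL : 2 * l + 2 * √(y + 1) ≤ x - y - 1) (hL' : 2 * l + 2 * √(y + 1) ≤ x')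
    (hσ : 0 ≤ σ) (hσy : 2 ≤ σ ^ 2 * y)
    (hend : ∀ w l' t, y ≤ w → w ≤ y + 1 → 0 ≤ t → t ^ 2 * (w - 1) ^ 2 ≤ 2 * w → l ≤ l' →
      l' ≤ l + 2 → CoverableWithin (trap w l' t) (l' * w + t * w ^ 2 / 2 + e)) :
    CoverableWithin (rectangle x x') (x * x' + 4 * e + (x + x') * σ) := by
  have hsq := Real.sqrt_nonneg (y + 1)
  have hband : ∀ w L, y ≤ w → w ≤ y + 1 → 2 * l + 2 * √(y + 1) ≤ L →
      CoverableWithin (rectangle w L) (w * L + 2 * e + L * σ) := by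
    intro w L h1 h2 h3
    have h4 : √w ≤ √(y + 1) := Real.sqrt_le_sqrt h2
    exact coverableWithin_band (by linarith) hl (by linarith) hσ
      (hσy.trans (mul_le_mul_of_nonneg_left h1 (sq_nonneg σ)))
      fun l' t => hend w l' t h1 h2
  obtain ⟨m, hm⟩ : ∃ m, m = ⌊x - y⌋₊ := ⟨_, rfl⟩
  obtain ⟨m', hm'⟩ : ∃ m', m' = ⌊x' - y⌋₊ := ⟨_, rfl⟩
  have hm1 : (m : ℝ) ≤ x - y := by rw [hm]; exact Nat.floor_le (by linarith)
  have hm2 : x - y - 1 ≤ m := by rw [hm]; linarith [Nat.lt_floor_add_one (x - y)]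
  have hm1' : (m' : ℝ) ≤ x' - y := by rw [hm']; exact Nat.floor_le (by linarith)
  have hm2' : x' - y - 1 ≤ m' := by rw [hm']; linarith [Nat.lt_floor_add_one (x' - y)]
  have hm0 : 0 < m := by
    have : 1 ≤ √(y + 1) := Real.one_le_sqrt.2 (by linarith)
    exact_mod_cast (show (0 : ℝ) < m by linarith)
  have hbox : CoverableBy {q : ℝ × ℝ | 0 ≤ q.1 ∧ q.1 ≤ m ∧ 0 ≤ q.2 ∧ q.2 < m'} (m * m') := by
    rcases Nat.eq_zero_or_pos m' with h | h
    · refine (coverableBy_empty _).mono ?_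
      rintro q ⟨-, -, h1, h2⟩
      rw [h] at h2
      push_cast at h2
      linarith
    · refine coverableBy_box 0 0 hm0 h ?_
      rintro q ⟨h1, h2, h3, h4⟩
      exact ⟨h1, by simpa using h2, h3, by linarith⟩
  have hright := (hband (x - m) x' (by linarith) (by linarith) hL').translate m 0
  have hupper := ((hband (x' - m') m (by linarith) (by linarith) (by linarith)).swap).translate
    0 m'
  refine ((CoverableWithin.union ⟨_, hbox, le_rfl⟩ hright).union hupper).mono ?_ ?_
  · rintro ⟨u, v⟩ ⟨⟨h1, h2⟩, h3, h4⟩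
    simp only at h1 h2 h3 h4
    rcases le_total u m with h | h
    · rcases lt_or_ge v m' with h' | h'
      · exact Or.inl (Or.inl ⟨h1, h, h3, h'⟩)
      · refine Or.inr ⟨⟨?_, ?_⟩, ?_, ?_⟩ <;> simp only <;> linarith
    · refine Or.inl (Or.inr ⟨⟨?_, ?_⟩, ?_, ?_⟩) <;> simp only <;> linarith
  · have : m * σ ≤ x * σ := mul_le_mul_of_nonneg_right (by linarith) hσ
    push_cast
    linarith

/-- Covering a trapezoid by upright rows, with waste of order one per row. -/
theorem coverableWithin_trap_rows {w a t : ℝ} (hw : 0 ≤ w) (ha : 0 ≤ a) (ht : 0 ≤ t) :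
    CoverableWithin (trap w a t)
      (a * w + t * w ^ 2 / 2 + (w + a + 1 + t * (2 * w + 3 / 2))) := by
  obtain ⟨n, hn⟩ : ∃ n, n = ⌊w⌋₊ + 1 := ⟨_, rfl⟩
  have hn1 : w < n := by rw [hn]; push_cast; exact Nat.lt_floor_add_one w
  have hn2 : (n : ℝ) ≤ w + 1 := by rw [hn]; push_cast; linarith [Nat.floor_le hw]
  let A : Fin n → Set (ℝ × ℝ) := fun i => {q | 0 ≤ q.1 ∧ q.1 ≤ a + t * (i + 1) ∧
    (i : ℝ) ≤ q.2 ∧ q.2 ≤ i + 1}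
  have hA : ∀ i, CoverableBy (A i) ((⌊a + t * ((i : ℕ) + 1)⌋₊ + 1) * 1) := by
    refine fun i => coverableBy_box 0 i (Nat.succ_pos _) one_pos ?_
    rintro q ⟨h1, h2, h3, h4⟩
    refine ⟨h1, ?_, h3, by simpa using h4⟩
    push_cast
    linarith [Nat.lt_floor_add_one (a + t * ((i : ℕ) + 1))]
  refine ⟨_, (CoverableBy.iUnion hA).mono ?_, ?_⟩
  · rintro q ⟨h1, h2, h3, h4⟩
    have h5 := Nat.floor_le h1
    have h6 := (Nat.lt_floor_add_one q.2).le
    exact Set.mem_iUnion.2 ⟨⟨⌊q.2⌋₊, (Nat.floor_lt h1).2 (by linarith)⟩, h3, by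
      simp only
      linarith [mul_le_mul_of_nonneg_left h6 ht], h5, h6⟩
  · have hle : ∀ i ∈ Finset.range n, (⌊a + t * ((i : ℕ) + 1)⌋₊ : ℝ) + 1 ≤
        (a + t + 1) + t * i := by
      intro i _
      linarith [Nat.floor_le (show 0 ≤ a + t * ((i : ℕ) + 1) by positivity)]
    have hsum := Finset.sum_le_sum hle
    rw [Finset.sum_add_distrib (g := fun i : ℕ => t * (i : ℝ)), Finset.sum_const,
      Finset.card_range, nsmul_eq_mul, ← Finset.mul_sum] at hsum
    push_cast [mul_one, Fin.sum_univ_eq_sum_range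
      (fun i : ℕ => (⌊a + t * ((i : ℕ) + 1)⌋₊ : ℝ) + 1)]
    refine hsum.trans ?_
    have h1 := mul_le_mul_of_nonneg_left (sum_range_cast_le n) ht
    have h2 : (n : ℝ) ^ 2 ≤ (w + 1) ^ 2 := pow_le_pow_left₀ (Nat.cast_nonneg n) hn2 2
    have h3 := mul_le_mul_of_nonneg_left h2 ht
    have h4 := mul_le_mul_of_nonneg_right hn2 (show 0 ≤ a + t + 1 by positivity)
    linarith

/-! ### Explicit bounds for rectangles -/

theorem coverableWithin_rectangle_grid {x x' : ℝ} (hx : 0 ≤ x) (hx' : 0 ≤ x') :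
    CoverableWithin (rectangle x x') ((x + 1) * (x' + 1)) := by
  refine ⟨_, coverableBy_box 0 0 (Nat.succ_pos ⌊x⌋₊) (Nat.succ_pos ⌊x'⌋₊) ?_, ?_⟩
  · rintro q ⟨⟨h1, h2⟩, h3, h4⟩
    have := (Nat.lt_floor_add_one x).le
    have := (Nat.lt_floor_add_one x').le
    push_cast
    exact ⟨h1, by linarith, h3, by linarith⟩
  · push_cast
    have := Nat.floor_le hx
    have := Nat.floor_le hx'
    gcongr

/-- The range `256 ≤ x ≤ 3 ^ 24`, with `x = z ^ 24` and bands of width `y = z ^ 16`. The waste is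
at most `(8.2 + (1 + c) * √2) * z ^ 16`, and `z ≤ 3`. -/
theorem coverableWithin_rectangle_of_medium {z c x' : ℝ} (hz2 : 2 ≤ z ^ 3) (hz3 : z ≤ 3)
    (hz : 1 ≤ z) (hc : c ≤ 7) (hx' : z ^ 18 ≤ x') (hx'c : x' ≤ c * z ^ 24) :
    CoverableWithin (rectangle (z ^ 24) x')
      (z ^ 24 * x' + ((15 + c) * √2 + 38) * z ^ 15) := by
  have hz0 : 0 < z := by linarith
  have h9 : 8 ≤ z ^ 9 := by
    calc (8 : ℝ) = 2 ^ 3 := by norm_num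
      _ ≤ (z ^ 3) ^ 3 := by gcongr
      _ = z ^ 9 := by ring
  have h16 : 40 ≤ z ^ 16 := by
    by_contra! h
    have h1 : (z ^ 16) ^ 3 < 40 ^ 3 := by gcongr
    have h2 : (2 : ℝ) ^ 16 ≤ (z ^ 3) ^ 16 := by gcongr
    have h3 : (z ^ 16) ^ 3 = (z ^ 3) ^ 16 := by ring
    rw [h3] at h1
    norm_num at h1 h2
    linarith
  obtain ⟨Z, hZ⟩ : ∃ Z, Z = z ^ 8 := ⟨_, rfl⟩
  have hZ0 : 0 < Z := by rw [hZ]; positivity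
  have hZ16 : z ^ 16 = Z ^ 2 := by rw [hZ]; ring
  have hZ24 : z ^ 24 = Z ^ 3 := by rw [hZ]; ring
  have hZ6 : 6 ≤ Z := by
    by_contra! h
    have : Z ^ 2 < 6 ^ 2 := by gcongr
    linarith
  have hZ18 : 8 * Z ≤ z ^ 18 := by
    have h10 : 8 ≤ z ^ 10 := by
      calc (8 : ℝ) ≤ z ^ 9 := h9
        _ ≤ z ^ 10 := pow_le_pow_right₀ hz (by norm_num)
    have : z ^ 18 = z ^ 10 * Z := by rw [hZ]; ring
    rw [this]
    gcongr
  have hZ2 : 6 * Z ≤ Z ^ 2 := by rw [sq]; gcongr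
  have hZ3 : 6 * Z ^ 2 ≤ Z ^ 3 := by
    linarith [mul_le_mul_of_nonneg_right hZ6 (sq_nonneg Z)]
  have hsq : √(z ^ 16 + 1) ≤ 2 * Z := by
    rw [Real.sqrt_le_left (by positivity)]
    linarith
  have h18 : z ^ 16 ≤ z ^ 18 := pow_le_pow_right₀ hz (by norm_num)
  have hcov := coverableWithin_rectangle_of_ends (x := z ^ 24) (x' := x') (y := z ^ 16) (l := 0)
    (e := 2 * (z ^ 16 + 1)) (σ := √2 / Z) h16 (h18.trans hx') le_rfl (by linarith) (by linarith)
    (by positivity) (by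
      rw [div_pow, Real.sq_sqrt (by norm_num), hZ16]
      exact (div_mul_cancel₀ _ (by positivity)).ge) (by
      intro w l' t h1 h2 h3 h4 h5 h6
      refine (coverableWithin_trap_rows (show 0 ≤ w by linarith) h5 h3).mono subset_rfl ?_
      have hw : 40 ≤ w := h16.trans h1
      have htw : t * w ≤ w / 4 := by
        apply le_of_sq_le_sq _ (by positivity)
        have h7 : (39 / 40 * w) ^ 2 ≤ (w - 1) ^ 2 :=
          pow_le_pow_left₀ (by linarith) (by linarith) 2
        have h8 := mul_le_mul_of_nonneg_left h7 (sq_nonneg t)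
        have h9 : 40 * w ≤ w ^ 2 := by rw [sq]; gcongr
        rw [mul_pow, div_pow]
        linarith
      have ht : t ≤ 1 / 4 := by
        by_contra! h
        linarith [mul_lt_mul_of_pos_right h (show 0 < w by linarith)]
      linarith)
  refine hcov.mono subset_rfl ?_
  have h1 : (z ^ 24 + x') * (√2 / Z) ≤ (1 + c) * √2 * z ^ 16 := by
    calc (z ^ 24 + x') * (√2 / Z) ≤ ((1 + c) * z ^ 24) * (√2 / Z) := by
          gcongr
          linarith
      _ = (1 + c) * √2 * z ^ 16 := by
          rw [hZ24, hZ16]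
          field_simp
  have h2 : z ^ 16 ≤ 3 * z ^ 15 := by
    linarith [mul_le_mul_of_nonneg_right hz3 (show 0 ≤ z ^ 15 by positivity)]
  have hc0 : 0 ≤ c := by
    by_contra! h
    have := mul_neg_of_neg_of_pos h (show 0 < z ^ 24 by positivity)
    have : 0 < z ^ 18 := by positivity
    linarith
  have hs2 : √2 ≤ 15 / 10 := by
    rw [Real.sqrt_le_left (by norm_num)]; norm_num
  have h3 : (1 + c) * √2 * z ^ 16 ≤ (1 + c) * √2 * (3 * z ^ 15) := by gcongr
  have h4 : 8 * z ^ 16 + 8 ≤ 25 * z ^ 15 := by linarith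
  have h5 : (1 + c) * √2 * 3 + 25 ≤ (15 + c) * √2 + 38 := by
    linarith [mul_le_mul_of_nonneg_right hc (Real.sqrt_nonneg 2), Real.sqrt_nonneg 2]
  have h6 := mul_le_mul_of_nonneg_right h5 (show 0 ≤ z ^ 15 by positivity)
  linarith

/-- The range `3 ^ 24 ≤ x`, with `x = z ^ 24` and bands of width `y = z ^ 18`. -/
theorem coverableWithin_rectangle_of_large {z c x' : ℝ} (hz : 3 ≤ z)
    (hx' : z ^ 18 ≤ x') (hx'c : x' ≤ c * z ^ 24) :
    CoverableWithin (rectangle (z ^ 24) x')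
      (z ^ 24 * x' + ((15 + c) * √2 + 38) * z ^ 15) := by
  have hz0 : 0 < z := by linarith
  obtain ⟨Z, hZ⟩ : ∃ Z, Z = z ^ 3 := ⟨_, rfl⟩
  have hZ27 : 27 ≤ Z := by
    calc (27 : ℝ) = 3 ^ 3 := by norm_num
      _ ≤ Z := by rw [hZ]; gcongr
  have hZ0 : 0 < Z := by linarith
  have hZ18 : z ^ 18 = Z ^ 6 := by rw [hZ]; ring
  have hZ24 : z ^ 24 = Z ^ 8 := by rw [hZ]; ring
  have hZ15 : z ^ 15 = Z ^ 5 := by rw [hZ]; ring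
  rw [hZ18] at hx'
  rw [hZ24] at hx'c
  rw [hZ24, hZ15]
  have hZ2 : 27 * Z ≤ Z ^ 2 := by rw [sq]; gcongr
  have hZ3 : 27 * Z ^ 2 ≤ Z ^ 3 := by
    linarith [mul_le_mul_of_nonneg_right hZ27 (sq_nonneg Z)]
  have hZ6 : 10000 * Z ^ 3 ≤ Z ^ 6 := by
    linarith [mul_le_mul_of_nonneg_right (show 10000 ≤ Z ^ 3 by linarith)
      (show 0 ≤ Z ^ 3 by positivity)]
  have hZ8 : 2 * Z ^ 6 ≤ Z ^ 8 := by
    linarith [mul_le_mul_of_nonneg_right (show 2 ≤ Z ^ 2 by linarith)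
      (show 0 ≤ Z ^ 6 by positivity)]
  have hsq : √(Z ^ 6 + 1) ≤ 2 * Z ^ 3 := by
    rw [Real.sqrt_le_left (by positivity)]
    linarith
  have hcov := coverableWithin_rectangle_of_ends (x := Z ^ 8) (x' := x') (y := Z ^ 6) (l := Z ^ 3)
    (e := 12 * Z ^ 5) (σ := √2 / Z ^ 3) (by linarith) hx' (by positivity)
    (by linarith) (by linarith) (by positivity) (by
      rw [div_pow, Real.sq_sqrt (by norm_num), ← pow_mul]
      exact (div_mul_cancel₀ _ (by positivity)).ge) (by
      intro w l' t h1 h2 h3 h4 h5 h6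
      have hw : 10000 ≤ w := by linarith
      -- The ends have height `w = r ^ 6`, with `r` hardly larger than `Z`.
      obtain ⟨r, hr0, hr⟩ : ∃ r : ℝ, 0 ≤ r ∧ r ^ 6 = w :=
        ⟨w ^ (1 / 6 : ℝ), by positivity, by
          rw [← Real.rpow_natCast, ← Real.rpow_mul (by linarith)]; norm_num⟩
      have hr1 : Z ≤ r := by
        refine le_of_pow_le_pow_left₀ (n := 6) (by norm_num) hr0 ?_
        rw [hr]
        exact h1
      have hr2 : r ≤ 101 / 100 * Z := by
        refine le_of_pow_le_pow_left₀ (n := 6) (by norm_num) (by positivity) ?_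
        rw [hr, mul_pow]
        norm_num
        linarith
      have hr3 : Z ^ 3 ≤ r ^ 3 := by gcongr
      have hr22 : r ^ 2 ≤ (101 / 100 * Z) ^ 2 := by gcongr
      have hr5 : r ^ 5 ≤ (101 / 100 * Z) ^ 5 := by gcongr
      have htr : t * r ^ 3 ≤ 71 / 50 := by
        apply le_of_sq_le_sq _ (by norm_num)
        have h7 : (999 / 1000 * w) ^ 2 ≤ (w - 1) ^ 2 :=
          pow_le_pow_left₀ (by linarith) (by linarith) 2
        have h8 := mul_le_mul_of_nonneg_left h7 (sq_nonneg t)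
        have h9 : (t * r ^ 3) ^ 2 = t ^ 2 * w := by rw [← hr]; ring
        rw [h9]
        refine le_of_mul_le_mul_right ?_ (show 0 < w by linarith)
        linarith
      have htrap := coverableWithin_trap (hZ27.trans hr1) h3 htr (a := l') (by linarith)
        (by linarith)
      rw [hr] at htrap
      refine htrap.mono subset_rfl ?_
      have : (101 / 100 * Z) ^ 5 ≤ 12 / 11 * Z ^ 5 := by
        rw [mul_pow]
        gcongr
        norm_num
      linarith)
  refine hcov.mono subset_rfl ?_
  have h1 : (Z ^ 8 + x') * (√2 / Z ^ 3) ≤ (1 + c) * √2 * Z ^ 5 := by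
    calc (Z ^ 8 + x') * (√2 / Z ^ 3) ≤ ((1 + c) * Z ^ 8) * (√2 / Z ^ 3) := by
          gcongr
          linarith
      _ = (1 + c) * √2 * Z ^ 5 := by field_simp
  have hs2 : 1 ≤ √2 := Real.one_le_sqrt.2 (by norm_num)
  have h5 : 0 ≤ Z ^ 5 := by positivity
  have h2 := mul_le_mul_of_nonneg_right hs2 h5
  linarith

/-- The bound for rectangles, with `x = z ^ 24` so that only integral powers occur. For
`x ≤ 256`, that is `z ^ 3 ≤ 2`, a grid suffices. -/
theorem coverableWithin_rectangle {z c x' : ℝ} (hz : 1 ≤ z) (hc : c ≤ 7)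
    (hx' : z ^ 18 ≤ x') (hx'c : x' ≤ c * z ^ 24) :
    CoverableWithin (rectangle (z ^ 24) x')
      (z ^ 24 * x' + ((15 + c) * √2 + 38) * z ^ 15) := by
  rcases le_total 2 (z ^ 3) with h2 | h2
  · rcases le_total z 3 with h3 | h3
    · exact coverableWithin_rectangle_of_medium h2 h3 hz hc hx' hx'c
    · exact coverableWithin_rectangle_of_large h3 hx' hx'c
  · have h18 : 0 < z ^ 18 := by positivity
    refine (coverableWithin_rectangle_grid (by positivity) (by linarith)).mono subset_rfl ?_
    have h9 : z ^ 9 ≤ 8 := by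
      calc z ^ 9 = (z ^ 3) ^ 3 := by ring
        _ ≤ 2 ^ 3 := by gcongr
        _ = 8 := by norm_num
    have h15 : 1 ≤ z ^ 15 := one_le_pow₀ hz
    have h24 : z ^ 24 ≤ 8 * z ^ 15 := by
      linarith [mul_le_mul_of_nonneg_right h9 (show 0 ≤ z ^ 15 by positivity)]
    have hc0 : 0 ≤ c := by
      by_contra! h
      have := mul_neg_of_neg_of_pos h (show 0 < z ^ 24 by positivity)
      linarith
    have hs2 : 14 / 10 ≤ √2 := Real.le_sqrt_of_sq_le (by norm_num)
    have h3 := mul_le_mul_of_nonneg_left h24 (show 0 ≤ 1 + c by linarith)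
    have h4 : (1 + c) * 8 + 1 ≤ (15 + c) * √2 + 38 := by
      linarith [mul_le_mul_of_nonneg_left hs2 (show 0 ≤ 15 + c by linarith)]
    have h5 := mul_le_mul_of_nonneg_right h4 (show 0 ≤ z ^ 15 by positivity)
    linarith

theorem coverableWithin_rectangle_rpow {c : ℝ} (hc : c ≤ 7) {x : ℝ} (hx : 1 ≤ x) {x' : ℝ}
    (hx' : x ^ (3 / 4 : ℝ) ≤ x') (hx'c : x' ≤ c * x) :
    CoverableWithin (rectangle x x') (x * x' + ((15 + c) * √2 + 38) * x ^ (5 / 8 : ℝ)) := by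
  have hx0 : 0 ≤ x := by linarith
  obtain ⟨z, hz⟩ : ∃ z : ℝ, z = x ^ (1 / 24 : ℝ) := ⟨_, rfl⟩
  have hpow : ∀ k : ℕ, z ^ k = x ^ (k / 24 : ℝ) := fun k => by
    rw [hz, ← Real.rpow_natCast, ← Real.rpow_mul hx0]
    congr 1
    ring
  have h24 : z ^ 24 = x := by rw [hpow]; norm_num
  have h18 : z ^ 18 = x ^ (3 / 4 : ℝ) := by rw [hpow]; norm_num
  have h15 : z ^ 15 = x ^ (5 / 8 : ℝ) := by rw [hpow]; norm_num
  have := coverableWithin_rectangle (z := z) (c := c) (x' := x')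
    (by rw [hz]; exact Real.one_le_rpow hx (by norm_num)) hc (by rwa [h18]) (by rwa [h24])
  rwa [h24, h15] at this

/-! ### Waste -/

theorem waste_rectangle_le {c : ℝ} (hc : c ≤ 7) {x : ℝ} (hx : 1 ≤ x) {x' : ℝ}
    (hx' : x ^ (3 / 4 : ℝ) ≤ x') (hx'c : x' ≤ c * x) :
    waste (rectangle x x') ≤ ((15 + c) * √2 + 38) * x ^ (5 / 8 : ℝ) := by
  have h := (coverableWithin_rectangle_rpow hc hx hx' hx'c).waste_le
  have h0 : 0 ≤ x ^ (3 / 4 : ℝ) := by positivity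
  rw [volume_rectangle (by linarith) (by linarith)] at h
  linarith

theorem CoverableWithin.waste_trapezoid_le {h a θ e : ℝ} (hh : 0 ≤ h) (ha : 0 ≤ a)
    (hθ : 0 ≤ Real.tan θ)
    (H : CoverableWithin (trap h a (Real.tan θ)) (a * h + Real.tan θ * h ^ 2 / 2 + e)) :
    waste (CoveringWaste.trapezoid h a θ) ≤ e := by
  have := H.trapezoid.waste_le
  rw [volume_trapezoid hh ha hθ] at this
  linarith

/-- The constant `71 / 50` exceeds `√2` by just enough to pass from the angle to its tangent. -/
theorem tan_mul_cube_le {r θ : ℝ} (hr : 27 ≤ r) (hθ0 : 0 < θ) (hθ : θ < √2 * (r ^ 3)⁻¹) :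
    0 ≤ Real.tan θ ∧ Real.tan θ * r ^ 3 ≤ 71 / 50 := by
  have hr3 : 1000 ≤ r ^ 3 := by
    calc (1000 : ℝ) ≤ 27 ^ 3 := by norm_num
      _ ≤ r ^ 3 := by gcongr
  have hr0 : 0 < r ^ 3 := by linarith
  rw [← div_eq_mul_inv, lt_div_iff₀ hr0] at hθ
  have hs2 : √2 ≤ 1415 / 1000 := by
    rw [Real.sqrt_le_left (by norm_num)]; norm_num
  have hsmall : θ ≤ 1 / 100 := by
    by_contra! h
    linarith [mul_lt_mul h hr3 (by norm_num) hθ0.le]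
  have hcos : 999 / 1000 ≤ Real.cos θ := by
    have h1 := Real.one_sub_sq_div_two_le_cos (x := θ)
    have h2 : θ ^ 2 ≤ (1 / 100) ^ 2 := by gcongr
    linarith
  have hpi := Real.pi_gt_three
  refine ⟨Real.tan_nonneg_of_nonneg_of_le_pi_div_two hθ0.le (by linarith), ?_⟩
  rw [Real.tan_eq_sin_div_cos, div_mul_eq_mul_div, div_le_iff₀ (by linarith)]
  have := mul_le_mul_of_nonneg_right (Real.sin_lt hθ0).le hr0.le
  linarith

/-- Trapezoids with an integral shorter edge `M`: a single slab with this `M`. -/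
theorem coverableWithin_trap_of_nat_edge {r h t : ℝ} {M : ℕ} (hr : 100 ≤ r) (ht : 0 ≤ t)
    (htr : t * r ^ 3 ≤ 71 / 50) (hM1 : (r - 1) ^ 2 ≤ M) (hM2 : M ≤ r ^ 2) (hh : 0 < h)
    (hhr : h ≤ 51 / 100 * r ^ 3) :
    CoverableWithin (trap h M t) (M * h + t * h ^ 2 / 2 + 7 * r ^ 2) := by
  obtain ⟨q, hqdef⟩ : ∃ q, q = √(M : ℝ) := ⟨_, rfl⟩
  have hM : (M : ℝ) = q ^ 2 := by rw [hqdef, Real.sq_sqrt (Nat.cast_nonneg _)]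
  have hqr : r - 1 ≤ q := by rw [hqdef]; exact Real.le_sqrt_of_sq_le hM1
  have hq4 : 4 / q ≤ 4 / 27 := by
    gcongr
    linarith
  have hr0 : 0 < r := by linarith
  have hr2 : 0 < r ^ 2 := by positivity
  have hr3 : 100 * r ^ 2 ≤ r ^ 3 := by
    linarith [mul_le_mul_of_nonneg_right hr hr2.le]
  have htM : 10 * t * M ≤ 1 := by
    have h1 : (M : ℝ) ≤ r ^ 3 / 20 := by linarith
    linarith [mul_le_mul_of_nonneg_left h1 ht]
  have htH : t * h ≤ 8 / 10 := by
    linarith [mul_le_mul_of_nonneg_left hhr ht]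
  have hslab := coverableWithin_slab (N := ⌈h⌉₊) (by linarith) hM ht htM hh (Nat.le_ceil h) le_rfl
    (by linarith)
  refine hslab.mono subset_rfl ?_
  have h1 : 4 * h / q ≤ 3 * r ^ 2 := by
    rw [div_le_iff₀ (by linarith)]
    linarith [mul_le_mul_of_nonneg_left hqr hr2.le]
  have h2 := Nat.ceil_lt_add_one hh.le
  have h3 : 100 * 100 ≤ r ^ 2 := by rw [sq]; gcongr
  linarith

/-- To show a property for large `x`, write `x = r ^ 6`. -/
theorem eventually_pow_six {P : ℝ → Prop} (r₀ : ℝ)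
    (h : ∀ᶠ x in atTop, ∀ r : ℝ, r₀ ≤ r → (∀ k : ℝ, x ^ k = r ^ (6 * k)) → r ^ 6 = x → P x) :
    ∀ᶠ x in atTop, P x := by
  have hlim := tendsto_rpow_atTop (show (0 : ℝ) < 1 / 6 by norm_num)
  filter_upwards [h, hlim.eventually_ge_atTop r₀, eventually_ge_atTop 0] with x hx hr hx0
  refine hx _ hr (fun k => ?_) ?_
  · rw [← Real.rpow_mul hx0]
    congr 1
    ring
  · rw [← Real.rpow_natCast, ← Real.rpow_mul hx0]
    norm_num

theorem eventually_waste_trapezoid_le {x' θ : ℝ → ℝ}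
    (hx' : Asymptotics.IsEquivalent atTop x' (fun x => 2 * x ^ (1 / 2 : ℝ)))
    (hθ : ∀ᶠ x in atTop, 0 < θ x ∧ θ x < √2 * x ^ (-(1 / 2) : ℝ)) :
    ∀ᶠ x in atTop, waste (trapezoid x (x' x) (θ x)) ≤ (19 / 2 + 7 / 2 * √2) * x ^ (5 / 6 : ℝ) := by
  have hs14 : 14 / 10 ≤ √2 := Real.le_sqrt_of_sq_le (by norm_num)
  apply eventually_pow_six 27
  filter_upwards [hx'.isLittleO.def (show (0 : ℝ) < 1 / 10 by norm_num), hθ] with x hxx hθx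
  rintro r hr hpow rfl
  have hr0 : 0 < r := by linarith
  have e1 : (r ^ 6) ^ (1 / 2 : ℝ) = r ^ 3 := by
    rw [hpow, ← Real.rpow_natCast]; norm_num
  have e2 : (r ^ 6) ^ (-(1 / 2) : ℝ) = (r ^ 3)⁻¹ := by
    rw [Real.rpow_neg (by positivity), e1]
  have e3 : (r ^ 6) ^ (5 / 6 : ℝ) = r ^ 5 := by
    rw [hpow, ← Real.rpow_natCast]; norm_num
  have hr3 : 27 * r ^ 2 ≤ r ^ 3 := by
    linarith [mul_le_mul_of_nonneg_right hr (sq_nonneg r)]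
  have hr2 : 1 ≤ r ^ 2 := one_le_pow₀ (by linarith)
  rw [e2] at hθx
  obtain ⟨ht0, ht⟩ := tan_mul_cube_le hr hθx.1 hθx.2
  simp only [Pi.sub_apply, e1, Real.norm_eq_abs] at hxx
  rw [abs_of_nonneg (show 0 ≤ 2 * r ^ 3 by positivity), abs_le] at hxx
  rw [e3]
  refine ((coverableWithin_trap hr ht0 ht (by linarith) (by linarith)).waste_trapezoid_le
    (by positivity) (by linarith) ht0).trans ?_
  gcongr
  linarith

theorem eventually_waste_trapezoid_floor_le {h θ : ℝ → ℝ}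
    (hh : Asymptotics.IsEquivalent atTop h (fun x => 1 / 2 * x ^ (1 / 2 : ℝ)))
    (hθ : ∀ᶠ x in atTop, 0 < θ x ∧ θ x < √2 * x ^ (-(1 / 2) : ℝ)) :
    ∀ᶠ x in atTop,
      waste (trapezoid (h x) (⌊x ^ (1 / 3 : ℝ) - √2 * x ^ (1 / 6 : ℝ)⌋ : ℝ) (θ x))
        ≤ (19 / 4 + 7 / 4 * √2) * x ^ (1 / 3 : ℝ) := by
  have hs14 : 14 / 10 ≤ √2 := Real.le_sqrt_of_sq_le (by norm_num)
  have hs15 : √2 ≤ 15 / 10 := by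
    rw [Real.sqrt_le_left (by norm_num)]; norm_num
  apply eventually_pow_six 100
  filter_upwards [hh.isLittleO.def (show (0 : ℝ) < 1 / 50 by norm_num), hθ] with x hxx hθx
  rintro r hr hpow rfl
  have hr0 : 0 < r := by linarith
  have e1 : (r ^ 6) ^ (1 / 2 : ℝ) = r ^ 3 := by
    rw [hpow, ← Real.rpow_natCast]; norm_num
  have e2 : (r ^ 6) ^ (-(1 / 2) : ℝ) = (r ^ 3)⁻¹ := by
    rw [Real.rpow_neg (by positivity), e1]
  have e3 : (r ^ 6) ^ (1 / 3 : ℝ) = r ^ 2 := by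
    rw [hpow, ← Real.rpow_natCast]; norm_num
  have e4 : (r ^ 6) ^ (1 / 6 : ℝ) = r := by
    rw [hpow]; norm_num
  have hr3 : 0 < r ^ 3 := by positivity
  rw [e2] at hθx
  obtain ⟨ht0, ht⟩ := tan_mul_cube_le (by linarith) hθx.1 hθx.2
  simp only [Pi.sub_apply, e1, Real.norm_eq_abs] at hxx
  rw [abs_of_nonneg (show 0 ≤ 1 / 2 * r ^ 3 by positivity), abs_le] at hxx
  rw [e3, e4]
  have h1 := Int.floor_le (r ^ 2 - √2 * r)
  have h2 := Int.lt_floor_add_one (r ^ 2 - √2 * r)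
  have h3 := mul_le_mul_of_nonneg_right hs15 hr0.le
  have h4 : 0 ≤ √2 * r := by positivity
  have h5 : 100 * r ≤ r ^ 2 := by rw [sq]; gcongr
  obtain ⟨M, hM⟩ : ∃ M : ℕ, (⌊r ^ 2 - √2 * r⌋ : ℤ) = M :=
    Int.eq_ofNat_of_zero_le (Int.floor_nonneg.2 (by linarith))
  rw [hM, Int.cast_natCast] at h1 h2 ⊢
  refine ((coverableWithin_trap_of_nat_edge (M := M) hr ht0 ht (by linarith) (by linarith)
    (by linarith) (by linarith)).waste_trapezoid_le
    (by linarith) (Nat.cast_nonneg M) ht0).trans ?_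
  gcongr
  linarith

end CoveringWaste

theorem theorem2 :
    -- (i) rectangles (Type 1)
    (∀ c : ℝ, c ≤ 7 → ∀ x : ℝ, 1 ≤ x → ∀ x' : ℝ, x ^ (3 / 4 : ℝ) ≤ x' → x' ≤ c * x →
      CoveringWaste.waste (CoveringWaste.rectangle x x')
        ≤ ((15 + c) * √2 + 38) * x ^ (5 / 8 : ℝ)) ∧
    -- (ii) trapezoids of height `x` (Type 2)
    (∀ x' θ : ℝ → ℝ,
      Asymptotics.IsEquivalent atTop x' (fun x => 2 * x ^ (1 / 2 : ℝ)) →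
      (∀ᶠ x in atTop, 0 < θ x ∧ θ x < √2 * x ^ (-(1 / 2) : ℝ)) →
      ∀ᶠ x in atTop,
        CoveringWaste.waste (CoveringWaste.trapezoid x (x' x) (θ x))
          ≤ (19 / 2 + 7 / 2 * √2) * x ^ (5 / 6 : ℝ)) ∧
    -- (iii) trapezoids with an integer top edge (Type 3)
    (∀ h θ : ℝ → ℝ,
      Asymptotics.IsEquivalent atTop h (fun x => 1 / 2 * x ^ (1 / 2 : ℝ)) →
      (∀ᶠ x in atTop, 0 < θ x ∧ θ x < √2 * x ^ (-(1 / 2) : ℝ)) →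
      ∀ᶠ x in atTop,
        CoveringWaste.waste
            (CoveringWaste.trapezoid (h x)
              (⌊x ^ (1 / 3 : ℝ) - √2 * x ^ (1 / 6 : ℝ)⌋ : ℝ) (θ x))
          ≤ (19 / 4 + 7 / 4 * √2) * x ^ (1 / 3 : ℝ)) ∧
    -- squares of side length `x`
    (∀ x : ℝ, 1 ≤ x →
      CoveringWaste.waste (CoveringWaste.rectangle x x) ≤ (16 * √2 + 38) * x ^ (5 / 8 : ℝ)) ∧
    -- `x ^ 2 + O(x ^ (5 / 8))` unit squares suffice to cover a square of side length `x`
    (∀ x : ℝ, 1 ≤ x → ∃ n : ℕ, CoveringWaste.CoverableBy (CoveringWaste.rectangle x x) n ∧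
      (n : ℝ) ≤ x ^ 2 + (16 * √2 + 38) * x ^ (5 / 8 : ℝ)) := by
  have hx34 : ∀ x : ℝ, 1 ≤ x → x ^ (3 / 4 : ℝ) ≤ x := fun x hx =>
    Real.rpow_le_self_of_one_le hx (by norm_num)
  refine ⟨fun c hc x hx x' h1 h2 => CoveringWaste.waste_rectangle_le hc hx h1 h2,
    fun x' θ h1 h2 => CoveringWaste.eventually_waste_trapezoid_le h1 h2,
    fun h θ h1 h2 => CoveringWaste.eventually_waste_trapezoid_floor_le h1 h2, ?_, ?_⟩
  · intro x hx
    have := CoveringWaste.waste_rectangle_le (c := 1) (by norm_num) hx (hx34 x hx) (one_mul x).ge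
    norm_num at this ⊢
    linarith
  · intro x hx
    obtain ⟨n, hn, hn'⟩ := CoveringWaste.coverableWithin_rectangle_rpow (c := 1) (by norm_num)
      hx (hx34 x hx) (one_mul x).ge
    exact ⟨n, hn, by linarith⟩
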